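/- Let $G=(V,E)$ be a finite connected simple graph that is triangle-free and has maximum degree at most $3$, let $w:E\to\mathbb{R}_{\ge 0}$ be a weight function on its edges, and for a subgraph $H$ of $G$ put $w(H)=\sum_{e\in E(H)}w(e)$. Let $\mathrm{mac}(G)$ denote the maximum weight of a cut of $G$, that is, the maximum over all partitions $(A,B)$ of $V$ into two (possibly empty) parts of the sum of $w(e)$ over all edges $e$ of $G$ with one endpoint in $A$ and the other in $B$. Then for every spanning tree $T$ of $G$, $$\mathrm{mac}(G)\;\ge\;\frac{w(G)}{2}+0.3193\cdot w(T).$$ -/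

import Mathlib

namespace WeightedCut

open Classical in
/-- The weight `w(H) = ∑_{e ∈ E(H)} w(e)` of a graph `H` on the finite vertex set `V`, where the
edges are weighted by `w` (only the values of `w` on edges of `H` matter). -/
noncomputable def weight {V : Type*} [Fintype V] (w : Sym2 V → ℝ) (H : SimpleGraph V) : ℝ :=
  ∑ e ∈ H.edgeFinset, w e

/-- The cut `(A, V \ A)` of `G`: the bipartite subgraph of `G` formed by the edges of `G` that join
`A` to its complement. -/
def cut {V : Type*} (G : SimpleGraph V) (A : Set V) : SimpleGraph V :=
  G.between A Aᶜ

/-- `mac(G)`: the maximum weight of a cut of `G`, over all bipartitions `(A, V \ A)` of the vertex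
set. -/
noncomputable def mac {V : Type*} [Fintype V] (G : SimpleGraph V) (w : Sym2 V → ℝ) : ℝ :=
  (Finset.univ : Finset (Finset V)).sup' Finset.univ_nonempty
    fun A => weight w (cut G (A : Set V))

end WeightedCut

/-! The constant obtained is 1/3. Root `T` at a vertex of degree at most one, and call a non-tree
edge a conflict if its ends have depths of equal parity. The tree edges are coloured by `ZMod 3` so
that all three colours occur on the tree path between the ends of every conflict
(`ConflictTree.exists_colouring`). For a colour `r`, delete the tree edges of colour `r`, split
every remaining component by depth parity, and flip the components independently and uniformly. A
tree edge is cut with probability 1/2 if it has colour `r` and 1 otherwise. A conflict joins two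
components and is cut with probability 1/2; any other non-tree edge is cut with probability at least
1/2. Averaged over `r`, tree edges are cut with probability 5/6 = 1/2 + 1/3, so some cut is heavy
enough.

The colour moves by a sign at each step down the tree, and the sign is inherited except where a
predicate `β` reverses it. Three consecutive edges going up from `v` show all colours unless the
sign is reversed at `v`, so each conflict becomes a local condition on `β` (`conf_cases` and the
`rainbow` lemmas). The reversals chosen are `Bit`. Its free part is a predicate `b`: some conditions
ask that two values of `b` be opposite, and these pairs form two matchings, `Matched` and `Link`,
whose union is bipartite; others ask that `b` be false at a `Demanding` vertex, and `chain_end`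
leads to at most one such vertex per component. Where requests would collide (`Gadget`), additional
reversals higher in the tree repair the conflict. -/

/-! ### Two-colouring the union of two matchings. -/

/-- Both involutions invert `σ = f ∘ g`, so they permute its cycles, and they send a given cycle to
the same other one. The cycles thus come in pairs, and `b` selects one of each pair. -/
theorem exists_bool_of_involutive {W : Type*} (f g : W → W) (hf : ∀ v, f (f v) = v)
    (hg : ∀ v, g (g v) = v) (hf' : ∀ v, f v ≠ v) (hg' : ∀ v, g v ≠ v) :
    ∃ b : W → Prop, (∀ v, b (f v) ↔ ¬ b v) ∧ (∀ v, b (g v) ↔ ¬ b v) := by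
  classical
  let F : Equiv.Perm W := ⟨f, f, hf, hf⟩
  let H : Equiv.Perm W := ⟨g, g, hg, hg⟩
  have hFF : F * F = 1 := Equiv.ext hf
  have hHH : H * H = 1 := Equiv.ext hg
  have hFi : F⁻¹ = F := rfl
  have hHi : H⁻¹ = H := rfl
  set σ : Equiv.Perm W := F * H with hσ
  have hσi : σ⁻¹ = H * F := by rw [hσ, mul_inv_rev, hFi, hHi]
  have conjF : ∀ k : ℤ, F * σ ^ k = σ ^ (-k) * F := by
    intro k
    have h1 : F * σ * F⁻¹ = σ⁻¹ := by
      rw [hσi, hσ, hFi, ← mul_assoc, hFF, one_mul]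
    have h2 : F * σ ^ k * F⁻¹ = (σ⁻¹) ^ k := by rw [← h1, conj_zpow]
    rw [zpow_neg, ← inv_zpow, ← h2, inv_mul_cancel_right]
  have hHσ : H = F * σ := by rw [hσ, ← mul_assoc, hFF, one_mul]
  -- If `f v = σ ^ k v`, then `σ ^ j v` is fixed by `f` when `k = 2 * j` and by `g` when `k = 2 * j
  -- + 1`.
  have noFix : ∀ v, ¬ σ.SameCycle v (f v) := by
    rintro v ⟨k, hk⟩
    have hk' : (σ ^ k) v = F v := hk
    rcases Int.even_or_odd' k with ⟨j, rfl | rfl⟩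
    · apply hf' ((σ ^ j) v)
      change F ((σ ^ j) v) = _
      rw [← Equiv.Perm.mul_apply, conjF, Equiv.Perm.mul_apply, ← hk', ← Equiv.Perm.mul_apply,
        ← zpow_add]
      congr 2; ring
    · apply hg' ((σ ^ j) v)
      have e : (F * σ ^ (1 + j)) v = (σ ^ j) v := by
        rw [conjF, Equiv.Perm.mul_apply, ← hk', ← Equiv.Perm.mul_apply, ← zpow_add]
        congr 2; ring
      calc H ((σ ^ j) v) = (F * σ ^ (1 + j)) v := by
            rw [zpow_add, zpow_one, ← mul_assoc, ← hHσ, Equiv.Perm.mul_apply]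
        _ = (σ ^ j) v := e
  have sameF : ∀ v w, σ.SameCycle v w → σ.SameCycle (f v) (f w) := by
    rintro v w ⟨k, hk⟩
    refine ⟨-k, ?_⟩
    change (σ ^ (-k)) (F v) = F w
    rw [← hk, ← Equiv.Perm.mul_apply, ← conjF, Equiv.Perm.mul_apply]
  have sameG : ∀ v, σ.SameCycle (g v) (f v) := by
    intro v
    refine ⟨1, ?_⟩
    change (σ ^ (1 : ℤ)) (H v) = F v
    rw [zpow_one, hσ, ← Equiv.Perm.mul_apply, mul_assoc, hHH, mul_one]
  let r : Setoid W :=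
    { r := fun v w => σ.SameCycle v w ∨ σ.SameCycle v (f w)
      iseqv :=
        { refl := fun v => Or.inl (Equiv.Perm.SameCycle.refl σ v)
          symm := by
            rintro v w (h | h)
            · exact Or.inl h.symm
            · right
              have := (sameF _ _ h).symm
              rwa [hf] at this
          trans := by
            rintro u v w (h | h) (h' | h')
            · exact Or.inl (h.trans h')
            · exact Or.inr (h.trans h')
            · exact Or.inr (h.trans (sameF _ _ h'))
            · left
              have := sameF _ _ h'
              rw [hf] at this
              exact h.trans this } }
  let rep : W → W := fun v => (Quotient.mk r v).out
  have hrep : ∀ v, r v (rep v) := fun v => r.symm (Quotient.mk_out (s := r) v)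
  have hrepF : ∀ v, rep (f v) = rep v := by
    intro v
    have : Quotient.mk r (f v) = Quotient.mk r v :=
      Quotient.sound (s := r) (Or.inr (Equiv.Perm.SameCycle.refl σ _))
    simp only [rep, this]
  have key : ∀ v, σ.SameCycle (f v) (rep v) ↔ ¬ σ.SameCycle v (rep v) := by
    intro v
    constructor
    · intro h h'
      exact noFix v (h'.trans h.symm)
    · intro h
      rcases hrep v with h1 | h1
      · exact absurd h1 h
      · have := sameF _ _ h1
        rwa [hf] at this
  have hrepG : ∀ v, rep (g v) = rep v := by
    intro v
    have : Quotient.mk r (g v) = Quotient.mk r v :=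
      Quotient.sound (s := r) (Or.inr (sameG v))
    simp only [rep, this]
  refine ⟨fun v => σ.SameCycle v (rep v), fun v => ?_, fun v => ?_⟩
  · simp only [hrepF]
    exact key v
  · simp only [hrepG]
    rw [← key v]
    exact ⟨fun h => (sameG v).symm.trans h, fun h => (sameG v).trans h⟩

open Classical in
/-- The involution attached to a matching given as a symmetric functional relation. -/
noncomputable def matchMap {V : Type*} (M : V → V → Prop) (v : V) : V :=
  if h : ∃ y, M v y then h.choose else v

theorem matchMap_eq {V : Type*} {M : V → V → Prop} (hM : ∀ x y z, M x y → M x z → y = z)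
    {x y : V} (h : M x y) : matchMap M x = y := by
  have h' : ∃ y, M x y := ⟨y, h⟩
  rw [matchMap, dif_pos h']
  exact hM _ _ _ h'.choose_spec h

theorem matchMap_involutive {V : Type*} {M : V → V → Prop} (hs : ∀ x y, M x y → M y x)
    (hM : ∀ x y z, M x y → M x z → y = z) (v : V) : matchMap M (matchMap M v) = v := by
  by_cases h : ∃ y, M v y
  · obtain ⟨y, hy⟩ := h
    rw [matchMap_eq hM hy, matchMap_eq hM (hs _ _ hy)]
  · have : matchMap M v = v := by rw [matchMap, dif_neg h]
    rw [this, this]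

/-- The union of two matchings is bipartite. -/
theorem exists_bool_of_matchings {V : Type*} (M O : V → V → Prop)
    (hMs : ∀ x y, M x y → M y x) (hM : ∀ x y z, M x y → M x z → y = z) (hMi : ∀ x, ¬ M x x)
    (hOs : ∀ x y, O x y → O y x) (hO : ∀ x y z, O x y → O x z → y = z) (hOi : ∀ x, ¬ O x x) :
    ∃ b : V → Prop, (∀ x y, M x y → (b y ↔ ¬ b x)) ∧ (∀ x y, O x y → (b y ↔ ¬ b x)) := by
  classical
  -- Passing to two copies of `V` removes fixed points: an unmatched vertex is exchanged with its
  -- own copy.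
  let L : (V → V) → V × Bool → V × Bool := fun f p => if f p.1 = p.1 then (p.1, !p.2) else (f p.1, p.2)
  have hL : ∀ f : V → V, (∀ v, f (f v) = v) → ∀ p, L f (L f p) = p := by
    rintro f hf ⟨v, i⟩
    by_cases h : f v = v
    · simp [L, h]
    · have : v ≠ f v := fun e => h e.symm
      simp [L, h, hf, this]
  have hL' : ∀ f : V → V, ∀ p, L f p ≠ p := by
    rintro f ⟨v, i⟩
    by_cases h : f v = v
    · simp [L, h]
    · simp [L, h]
  obtain ⟨b, hb1, hb2⟩ := exists_bool_of_involutive (L (matchMap M)) (L (matchMap O))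
    (hL _ (matchMap_involutive hMs hM)) (hL _ (matchMap_involutive hOs hO)) (hL' _) (hL' _)
  have aux : ∀ (R : V → V → Prop), (∀ x y z, R x y → R x z → y = z) → (∀ x, ¬ R x x) →
      ∀ x y, R x y → L (matchMap R) (x, false) = (y, false) := by
    intro R hR hi x y h
    have hxy : y ≠ x := fun e => hi x (e ▸ h)
    simp [L, matchMap_eq hR h, hxy]
  refine ⟨fun v => b (v, false), fun x y h => ?_, fun x y h => ?_⟩
  · rw [← hb1, aux M hM hMi x y h]
  · rw [← hb2, aux O hO hOi x y h]

/-- A proper 2-colouring of the union of two matchings that takes the value `False` on a set with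
at most one element in every component. -/
theorem exists_bool_of_matchings_of_demand {V : Type*} (M O : V → V → Prop) (D : V → Prop)
    (hMs : ∀ x y, M x y → M y x) (hM : ∀ x y z, M x y → M x z → y = z) (hMi : ∀ x, ¬ M x x)
    (hOs : ∀ x y, O x y → O y x) (hO : ∀ x y z, O x y → O x z → y = z) (hOi : ∀ x, ¬ O x x)
    (C : V → V → Prop) (hCM : ∀ x v w, D x → C x v → M v w → C x w)
    (hCO : ∀ x v w, D x → C x v → O v w → C x w) (hC : ∀ x, D x → C x x)
    (hCD : ∀ x y, D x → D y → C x y → y = x) :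
    ∃ b : V → Prop, (∀ x y, M x y → (b y ↔ ¬ b x)) ∧ (∀ x y, O x y → (b y ↔ ¬ b x)) ∧
      ∀ x, D x → ¬ b x := by
  obtain ⟨b, h1, h2⟩ := exists_bool_of_matchings M O hMs hM hMi hOs hO hOi
  have hCM' : ∀ x v w, D x → M v w → (C x w ↔ C x v) := fun x v w hx h =>
    ⟨fun h' => hCM x w v hx h' (hMs _ _ h), fun h' => hCM x v w hx h' h⟩
  have hCO' : ∀ x v w, D x → O v w → (C x w ↔ C x v) := fun x v w hx h =>
    ⟨fun h' => hCO x w v hx h' (hOs _ _ h), fun h' => hCO x v w hx h' h⟩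
  -- The colouring is reversed on the sets `C x` with `D x` and `b x`; membership in `C x` is
  -- constant along both matchings.
  refine ⟨fun v => ¬ (b v ↔ ∃ x, D x ∧ C x v ∧ b x), fun x y h => ?_, fun x y h => ?_,
    fun x hx => ?_⟩
  · have : (∃ z, D z ∧ C z y ∧ b z) ↔ ∃ z, D z ∧ C z x ∧ b z := by
      refine exists_congr fun z => and_congr_right fun hz => ?_
      rw [hCM' z x y hz h]
    beta_reduce
    rw [this, h1 x y h]
    generalize (∃ z, D z ∧ C z x ∧ b z) = q
    by_cases hb : b x <;> by_cases hq : q <;> simp [hb, hq]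
  · have : (∃ z, D z ∧ C z y ∧ b z) ↔ ∃ z, D z ∧ C z x ∧ b z := by
      refine exists_congr fun z => and_congr_right fun hz => ?_
      rw [hCO' z x y hz h]
    beta_reduce
    rw [this, h2 x y h]
    generalize (∃ z, D z ∧ C z x ∧ b z) = q
    by_cases hb : b x <;> by_cases hq : q <;> simp [hb, hq]
  · rw [not_not]
    constructor
    · exact fun h => ⟨x, hx, hC x hx, h⟩
    · rintro ⟨z, hz, hzx, hb⟩
      rwa [hCD z x hz hx hzx]

/-! ### Conflict trees and the pairs that request opposite bits. -/

/-- A rooted tree of maximum degree at most `3`, given by a parent map and a depth function, whose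
root has at most one child, together with a symmetric relation `Conf` between vertices at even
distance at least `4` such that the tree edges and the conflicts at any vertex number at most `3`. -/
structure ConflictTree (V : Type*) where
  par : V → V
  dep : V → ℕ
  Conf : V → V → Prop
  dep_par : ∀ v, dep v ≠ 0 → dep v = dep (par v) + 1
  par_root : ∀ v, dep v = 0 → par v = v
  root_unique : ∀ v w, dep v = 0 → dep w = 0 → v = w
  root_child : ∀ v w, dep v = 1 → dep w = 1 → v = w
  symm : ∀ x y, Conf x y → Conf y x
  parity : ∀ x y, Conf x y → dep x % 2 = dep y % 2
  irrefl : ∀ x, ¬ Conf x x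
  triangle : ∀ x y z, Conf x y → Conf y z → ¬ Conf x z
  par_ne : ∀ x y, Conf x y → par x ≠ par y
  grandpar_ne : ∀ x y, Conf x y → par (par x) ≠ y
  -- In the names, `k` is a child and `c` a conflict; away from the root the parent edge uses up one
  -- of the three places.
  deg_kkk : ∀ a b c, par a = par b → par a = par c → dep a ≠ 0 → dep b ≠ 0 → dep c ≠ 0 →
    a = b ∨ a = c ∨ b = c
  deg_kkc : ∀ v a b y, par a = v → par b = v → dep a ≠ 0 → dep b ≠ 0 → Conf v y → a = b
  deg_kcc : ∀ v a y z, par a = v → dep a ≠ 0 → dep v ≠ 0 → Conf v y → Conf v z → y = z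
  deg_ccc : ∀ v x y z, dep v ≠ 0 → Conf v x → Conf v y → Conf v z → x = y ∨ x = z ∨ y = z

namespace ConflictTree

variable {V : Type*} (S : ConflictTree V)

/-- `z` is an ancestor of `x` (possibly `x` itself). -/
inductive Anc (z : V) : V → Prop
  | refl : Anc z z
  | step (x : V) : S.dep x ≠ 0 → Anc z (S.par x) → Anc z x

theorem anc_iff (z x : V) : S.Anc z x ↔ z = x ∨ (S.dep x ≠ 0 ∧ S.Anc z (S.par x)) := by
  constructor
  · rintro (_ | ⟨_, h1, h2⟩)
    · exact Or.inl rfl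
    · exact Or.inr ⟨h1, h2⟩
  · rintro (rfl | ⟨h1, h2⟩)
    · exact .refl
    · exact .step _ h1 h2

theorem Anc.dep_le {z x : V} (h : S.Anc z x) : S.dep z ≤ S.dep x := by
  induction h with
  | refl => exact le_rfl
  | step x hx _ ih => have := S.dep_par x hx; omega

theorem Anc.eq_of_dep {z x : V} (h : S.Anc z x) (hd : S.dep x ≤ S.dep z) : z = x := by
  rcases (S.anc_iff z x).1 h with h | ⟨h1, h2⟩
  · exact h
  · have := Anc.dep_le S h2
    have := S.dep_par x h1
    omega

theorem anc_root {z : V} (hz : S.dep z = 0) (x : V) : S.Anc z x := by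
  induction hn : S.dep x generalizing x with
  | zero => rw [S.root_unique z x hz hn]; exact .refl
  | succ n ih =>
    have := S.dep_par x (by omega)
    exact .step _ (by omega) (ih _ (by omega))

theorem Anc.exists_child {z x : V} (h : S.Anc z x) (hne : z ≠ x) :
    ∃ k, S.par k = z ∧ S.dep k ≠ 0 ∧ S.Anc k x := by
  induction h with
  | refl => exact absurd rfl hne
  | step x hx h ih =>
    by_cases e : z = S.par x
    · exact ⟨x, e.symm, hx, .refl⟩
    · obtain ⟨k, h1, h2, h3⟩ := ih e
      exact ⟨k, h1, h2, .step _ hx h3⟩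

/-- A conflict between two vertices of the same depth with the same grandparent. -/
def Inner (x y : V) : Prop :=
  S.Conf x y ∧ S.dep x = S.dep y ∧ S.par (S.par x) = S.par (S.par y)

def Double (v : V) : Prop := ∃ a b, a ≠ b ∧ S.Inner v a ∧ S.Inner v b

/-- An inner conflict both of whose ends have no other inner conflict. -/
def Matched (x y : V) : Prop :=
  S.Inner x y ∧ (∀ z, S.Inner x z → z = y) ∧ ∀ z, S.Inner y z → z = x

/-- `y` has a conflict with a vertex that is not deeper, and the closest common ancestor is the
fourth ancestor of `y`. -/
def LongFour (y : V) : Prop :=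
  ∃ z, S.Conf y z ∧ S.Anc (S.par (S.par (S.par (S.par y)))) z ∧
    ¬ S.Anc (S.par (S.par (S.par y))) z ∧ S.dep z ≤ S.dep y

def Stacked (y u : V) : Prop :=
  u = S.par y ∧ (∃ x, S.Matched y x) ∧ (∃ w, S.Matched u w) ∧ S.LongFour y

/-- A conflict between `x` and the sibling `s` of its grandparent. -/
def Demand (x s : V) : Prop :=
  S.Conf x s ∧ S.dep x = S.dep s + 2 ∧ S.par (S.par (S.par x)) = S.par s ∧ S.par (S.par x) ≠ s

/-- The demand makes the bit of `x` false, and the chain `x, y, u, w` then forces that of `w` to be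
true. A demand or level conflict at `w` therefore cannot rely on the bit of `w`, which is why gadget
ends are exempt in `LevelLink` and `Demanding`. -/
def Gadget (x y u w s : V) : Prop :=
  S.Demand x s ∧ S.Matched x y ∧ S.Stacked y u ∧ S.Matched u w

def GadgetEnd (w : V) : Prop := ∃ x y u s, S.Gadget x y u w s

/-- A conflict between two vertices of the same depth whose closest common ancestor is their third
ancestor. -/
def Level (x z : V) : Prop :=
  S.Conf x z ∧ S.dep x = S.dep z ∧ S.par (S.par (S.par x)) = S.par (S.par (S.par z)) ∧
    S.par (S.par x) ≠ S.par (S.par z)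

def LevelLink (x z : V) : Prop :=
  S.Level x z ∧ (∃ y, S.Matched x y) ∧ (∃ y, S.Matched z y) ∧ ¬ S.GadgetEnd x ∧ ¬ S.GadgetEnd z

def Link (x z : V) : Prop := S.LevelLink x z ∨ S.Stacked x z ∨ S.Stacked z x

def Demanding (x : V) : Prop := (∃ y, S.Matched x y) ∧ (∃ s, S.Demand x s) ∧ ¬ S.GadgetEnd x

variable {S}

theorem dep_par_of_pos {v : V} {n : ℕ} (h : S.dep v = n + 1) : S.dep (S.par v) = n := by
  have := S.dep_par v (by omega)
  omega

theorem dep_par_eq (v : V) : S.dep (S.par v) = S.dep v - 1 := by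
  by_cases h : S.dep v = 0
  · rw [S.par_root v h, h]
  · have := S.dep_par v h
    omega

theorem Inner.symm {x y : V} (h : S.Inner x y) : S.Inner y x :=
  ⟨S.symm _ _ h.1, h.2.1.symm, h.2.2.symm⟩

theorem Inner.par_ne {x y : V} (h : S.Inner x y) : S.par x ≠ S.par y := S.par_ne _ _ h.1

theorem Conf.ne {x y : V} (h : S.Conf x y) : x ≠ y := by
  rintro rfl
  exact S.irrefl _ h

theorem Inner.dep {x y : V} (h : S.Inner x y) : 3 ≤ S.dep x := by
  have h1 := h.2.1
  have h2 := dep_par_eq (S := S) x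
  have h3 := dep_par_eq (S := S) y
  by_contra hlt
  have h4 : S.dep x = 0 ∨ S.dep x = 1 ∨ S.dep x = 2 := by omega
  rcases h4 with h4 | h4 | h4
  · exact h.1.ne (S.root_unique _ _ h4 (by omega))
  · exact h.1.ne (S.root_child _ _ h4 (by omega))
  · exact h.par_ne (S.root_child _ _ (by omega) (by omega))

theorem Matched.symm {x y : V} (h : S.Matched x y) : S.Matched y x := ⟨h.1.symm, h.2.2, h.2.1⟩

theorem Matched.unique {x y z : V} (h : S.Matched x y) (h' : S.Matched x z) : y = z :=
  h'.2.1 _ h.1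

theorem Matched.not_double {x y : V} (h : S.Matched x y) : ¬ S.Double x := by
  rintro ⟨a, b, hab, ha, hb⟩
  exact hab ((h.2.1 _ ha).trans (h.2.1 _ hb).symm)

/-- The closest common ancestor of an inner conflict has no conflict. -/
theorem Inner.not_conf_grandpar {x y z : V} (h : S.Inner x y) : ¬ S.Conf (S.par (S.par x)) z := by
  intro hz
  have hd := h.dep
  have h1 := dep_par_eq (S := S) x
  have h2 := dep_par_eq (S := S) y
  have h3 := h.2.1
  exact h.par_ne (S.deg_kkc _ _ _ z rfl h.2.2.symm (by omega) (by omega) hz)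

theorem Level.symm {x z : V} (h : S.Level x z) : S.Level z x :=
  ⟨S.symm _ _ h.1, h.2.1.symm, h.2.2.1.symm, h.2.2.2.symm⟩

theorem Level.not_inner {x z : V} (h : S.Level x z) : ¬ S.Inner x z := fun h' => h.2.2.2 h'.2.2

theorem LevelLink.symm {x z : V} (h : S.LevelLink x z) : S.LevelLink z x :=
  ⟨h.1.symm, h.2.2.1, h.2.1, h.2.2.2.2, h.2.2.2.1⟩

theorem Link.symm {x z : V} (h : S.Link x z) : S.Link z x := by
  rcases h with h | h | h
  · exact Or.inl h.symm
  · exact Or.inr (Or.inr h)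
  · exact Or.inr (Or.inl h)

theorem Stacked.ne {y u : V} (h : S.Stacked y u) : y ≠ u := by
  rintro rfl
  obtain ⟨h1, ⟨x, hx⟩, -, -⟩ := h
  have := hx.1.dep
  have h2 := dep_par_eq (S := S) y
  rw [← h1] at h2
  omega

theorem Link.ne {x z : V} (h : S.Link x z) : x ≠ z := by
  rcases h with h | h | h
  · exact h.1.1.ne
  · exact h.ne
  · exact h.ne.symm

theorem Matched.not_matched_of_child {y x a z : V} (h : S.Matched y x) (ha : S.par a = y)
    (had : S.dep a ≠ 0) (hz : S.Conf y z) : z = x :=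
  S.deg_kcc y a z x ha had (by have := h.1.dep; omega) hz h.1.1

/-- A vertex with an inner conflict and another conflict is a leaf. -/
theorem Inner.no_child {y x a z : V} (h : S.Inner y x) (hz : S.Conf y z) (hzx : z ≠ x)
    (ha : S.par a = y) : S.dep a = 0 := by
  by_contra had
  exact hzx (S.deg_kcc y a z x ha had (by have := h.dep; omega) hz h.1)

theorem Matched.conf_eq {y x z z' : V} (h : S.Matched y x) (hz : S.Conf y z) (hzx : z ≠ x)
    (hz' : S.Conf y z') (hzx' : z' ≠ x) : z = z' := by
  rcases S.deg_ccc y x z z' (by have := h.1.dep; omega) h.1.1 hz hz' with h | h | h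
  · exact absurd h.symm hzx
  · exact absurd h.symm hzx'
  · exact h

/-- Inner, level and demand conflicts all stay below the third ancestor of `y`, so the long conflict
is a further one. -/
theorem LongFour.exists_ne {y x : V} (h : S.LongFour y) (hx : S.Inner y x) :
    ∃ z, S.Conf y z ∧ z ≠ x ∧ ¬ S.Level y z ∧ (∀ s, S.Demand y s → z ≠ s) ∧
      S.Anc (S.par (S.par (S.par (S.par y)))) z ∧
      ¬ S.Anc (S.par (S.par (S.par y))) z ∧ S.dep z ≤ S.dep y ∧ 4 ≤ S.dep y := by
  obtain ⟨z, h1, h2, h3, h4⟩ := h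
  have hd := hx.dep
  have e0 := dep_par_eq (S := S) y
  have e1 := dep_par_eq (S := S) (S.par y)
  have e2 := dep_par_eq (S := S) (S.par (S.par y))
  have hd4 : 4 ≤ S.dep y := by
    by_contra hlt
    exact h3 (S.anc_root (by omega) z)
  have up : ∀ v w, S.dep w ≠ 0 → S.par w = v → S.Anc v w := fun v w hw e =>
    .step _ hw (e ▸ .refl)
  have up3 : ∀ z', S.dep z' = S.dep y → S.par (S.par (S.par z')) = S.par (S.par (S.par y)) →
      S.Anc (S.par (S.par (S.par y))) z' := by
    intro z' hz he
    have f0 := dep_par_eq (S := S) z'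
    have f1 := dep_par_eq (S := S) (S.par z')
    refine .step _ (by omega) (.step _ (by omega) (.step _ (by omega) ?_))
    rw [he]
    exact .refl
  refine ⟨z, h1, ?_, ?_, ?_, h2, h3, h4, hd4⟩
  · rintro rfl
    exact h3 (up3 _ hx.2.1.symm (by rw [hx.2.2]))
  · intro hl
    exact h3 (up3 _ hl.2.1.symm hl.2.2.1.symm)
  · rintro s hs rfl
    have := hs.2.1
    exact h3 (up _ _ (by omega) hs.2.2.1.symm)

/-- A matched vertex has at most one conflict besides its partner. If it has one, it is a leaf, and
a level link or a stacked link to its parent is determined by that conflict. Otherwise only stacked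
children remain, and a vertex with a conflict has at most one child. -/
theorem Link.unique {a b b' : V} (h : S.Link a b) (h' : S.Link a b') : b = b' := by
  have key : ∀ b b', S.Link a b → S.Link a b' → S.LevelLink a b ∨ S.Stacked a b →
      b = b' := by
    intro b b' _ h' h
    rcases h with h | h
    · obtain ⟨y, hy⟩ := h.2.1
      have hby : b ≠ y := by rintro rfl; exact h.1.not_inner hy.1
      rcases h' with h' | h' | h'
      · exact hy.conf_eq h.1.1 hby h'.1.1 (by rintro rfl; exact h'.1.not_inner hy.1)
      · obtain ⟨z, hz, hzy, hzl, -⟩ := h'.2.2.2.exists_ne hy.1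
        rw [hy.conf_eq hz hzy h.1.1 hby] at hzl
        exact absurd h.1 hzl
      · obtain ⟨x, hx⟩ := h'.2.1
        have := hy.1.no_child h.1.1 hby h'.1.symm
        have := hx.1.dep
        omega
    · obtain ⟨y, hy⟩ := h.2.1
      obtain ⟨z, hz, hzy, hzl, -⟩ := h.2.2.2.exists_ne hy.1
      rcases h' with h' | h' | h'
      · rw [hy.conf_eq hz hzy h'.1.1 (by rintro rfl; exact h'.1.not_inner hy.1)] at hzl
        exact absurd h'.1 hzl
      · rw [h.1, h'.1]
      · obtain ⟨x, hx⟩ := h'.2.1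
        have := hy.1.no_child hz hzy h'.1.symm
        have := hx.1.dep
        omega
  have h0 := h
  have h0' := h'
  rcases h with h | h | h
  · exact key b b' h0 h0' (Or.inl h)
  · exact key b b' h0 h0' (Or.inr h)
  · rcases h' with h' | h' | h'
    · exact (key b' b h0' h0 (Or.inl h')).symm
    · exact (key b' b h0' h0 (Or.inr h')).symm
    · obtain ⟨y, hy⟩ := h.2.2.1
      obtain ⟨x, hx⟩ := h.2.1
      obtain ⟨x', hx'⟩ := h'.2.1
      have := hx.1.dep
      have := hx'.1.dep
      exact S.deg_kkc a b b' y h.1.symm h'.1.symm (by omega) (by omega) hy.1.1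

end ConflictTree

/-! ### Components of the two matchings that contain a demanding vertex. -/

namespace ConflictTree

variable {V : Type*} {S : ConflictTree V}

theorem dep_pars (v : V) : S.dep (S.par v) = S.dep v - 1 ∧ S.dep (S.par (S.par v)) = S.dep v - 2 ∧
    S.dep (S.par (S.par (S.par v))) = S.dep v - 3 ∧
    S.dep (S.par (S.par (S.par (S.par v)))) = S.dep v - 4 := by
  have e0 := dep_par_eq (S := S) v
  have e1 := dep_par_eq (S := S) (S.par v)
  have e2 := dep_par_eq (S := S) (S.par (S.par v))
  have e3 := dep_par_eq (S := S) (S.par (S.par (S.par v)))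
  omega

theorem Inner.child_cases {x y v : V} (h : S.Inner x y) (hv : S.par v = S.par (S.par x))
    (hd : S.dep v ≠ 0) : v = S.par x ∨ v = S.par y := by
  have := h.dep
  have := h.2.1
  have := dep_pars (S := S) x
  have := dep_pars (S := S) y
  rcases S.deg_kkk v (S.par x) (S.par y) hv (hv.trans h.2.2) hd (by omega) (by omega) with e | e | e
  · exact Or.inl e
  · exact Or.inr e
  · exact absurd e h.par_ne

theorem Demand.dep {x s : V} (h : S.Demand x s) : 3 ≤ S.dep x ∧ S.dep s ≠ 0 := by
  have h0 := h.2.1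
  have := dep_pars (S := S) x
  have : S.dep s ≠ 0 := by
    intro e
    exact h.2.2.2 (S.root_unique _ _ (by omega) e)
  omega

theorem Demand.child_cases {x s v : V} (h : S.Demand x s) (hv : S.par v = S.par s)
    (hd : S.dep v ≠ 0) : v = s ∨ v = S.par (S.par x) := by
  have := h.dep
  have := dep_pars (S := S) x
  rcases S.deg_kkk v s (S.par (S.par x)) hv (hv.trans h.2.2.1.symm) hd (by omega) (by omega)
    with e | e | e
  · exact Or.inl e
  · exact Or.inr e
  · exact absurd e.symm h.2.2.2

theorem Demand.unique {x y s s' : V} (h : S.Demand x s) (h' : S.Demand y s')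
    (hxy : S.par (S.par x) = S.par (S.par y)) : s = s' := by
  rcases h'.child_cases (v := s) (by rw [← h.2.2.1, ← h'.2.2.1, hxy]) h.dep.2 with e | e
  · exact e
  · exact absurd (hxy.trans e.symm) h.2.2.2

theorem Demand.ne_inner {x s y : V} (h : S.Demand x s) (h' : S.Inner x y) : s ≠ y := by
  rintro rfl
  have := h.2.1
  have := h'.2.1
  omega

theorem Demand.not_double {x s : V} (h : S.Demand x s) : ¬ S.Double x := by
  rintro ⟨a, b, hab, ha, hb⟩
  rcases S.deg_ccc x a b s (by have := h.dep; omega) ha.1 hb.1 h.1 with e | e | e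
  · exact hab e
  · exact h.ne_inner ha e.symm
  · exact h.ne_inner hb e.symm

/-- Here `s` is the sibling of the third ancestor of `y`. The far end of the long conflict lies
below `s`, and differs from `s` by depth parity. -/
theorem LongFour.exists_child {x y s : V} (h : S.LongFour y) (hx : S.Inner y x)
    (hs : S.par s = S.par (S.par (S.par (S.par y)))) (hd : S.dep s ≠ 0)
    (hne : s ≠ S.par (S.par (S.par y))) :
    ∃ k, S.par k = s ∧ S.dep k ≠ 0 ∧ ∃ z, S.Conf y z ∧ z ≠ x ∧ S.Anc k z := by
  obtain ⟨z, h1, hzx, -, -, h2, h3, h4, h5⟩ := h.exists_ne hx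
  have hdy := dep_pars (S := S) y
  have hpar := S.parity _ _ h1
  have hds := S.dep_par s hd
  have hq : S.dep s = S.dep y - 3 := by rw [hs] at hds; omega
  have hkk : ∀ w, ¬ S.Conf (S.par (S.par (S.par (S.par y)))) w := fun w hw =>
    hne (S.deg_kkc _ _ _ w hs rfl hd (by omega) hw)
  obtain ⟨k, hk1, hk2, hk3⟩ := Anc.exists_child S h2
    (by rintro e; rw [← e] at h1; exact hkk _ (S.symm _ _ h1))
  have hks : k = s := by
    rcases S.deg_kkk k s (S.par (S.par (S.par y))) (hk1.trans hs.symm) hk1 hk2 hd (by omega)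
      with e | e | e
    · exact e
    · rw [e] at hk3; exact absurd hk3 h3
    · exact absurd e hne
  subst hks
  obtain ⟨k', hk1', hk2', hk3'⟩ := Anc.exists_child S hk3 (by rintro rfl; omega)
  exact ⟨k', hk1', hk2', z, h1, hzx, hk3'⟩

theorem Gadget.par_end {x y u w s : V} (h : S.Gadget x y u w s) : S.par w = s := by
  obtain ⟨hD, hM, hS, hM'⟩ := h
  have e : S.par (S.par w) = S.par s := by
    rw [← hM'.1.2.2, hS.1, ← hD.2.2.1, ← hM.1.2.2]
  have := hM'.1.dep
  have := hM'.1.2.1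
  have := dep_pars (S := S) w
  rcases hD.child_cases e (by omega) with e' | e'
  · exact e'
  · exact absurd (by rw [e', hS.1, hM.1.2.2]) hM'.1.par_ne

theorem Gadget.dep {x y u w s : V} (h : S.Gadget x y u w s) :
    S.dep y = S.dep x ∧ S.dep u = S.dep x - 1 ∧ S.dep w = S.dep x - 1 ∧ S.dep s = S.dep x - 2 ∧
      4 ≤ S.dep x := by
  obtain ⟨hD, hM, hS, hM'⟩ := h
  have h1 := hM.1.2.1
  have h2 := hM'.1.2.1
  have h3 := hD.2.1
  have h4 := hM'.1.dep
  have h5 := dep_pars (S := S) y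
  rw [← hS.1] at h5
  omega

theorem Gadget.swap_end {x y u w s : V} (h : S.Gadget x y u w s) {s' : V} (h' : S.Demand w s') :
    ∃ k, S.par k = s' ∧ S.dep k ≠ 0 := by
  have hp := h.par_end
  obtain ⟨hD, hM, hS, hM'⟩ := h
  have e : S.par (S.par w) = S.par (S.par (S.par y)) := by
    rw [hp, ← hD.2.2.1, ← hM.1.2.2]
  obtain ⟨k, h1, h2, -⟩ := hS.2.2.2.exists_child hM.1.symm (s := s')
    (by rw [← h'.2.2.1, e]) h'.dep.2 (by rw [← e]; exact h'.2.2.2.symm)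
  exact ⟨k, h1, h2⟩

theorem Demanding.not_link {x v : V} (h : S.Demanding x) : ¬ S.Link x v := by
  obtain ⟨⟨y, hy⟩, ⟨s, hs⟩, -⟩ := h
  have hsy := hs.ne_inner hy.1
  rintro (h' | h' | h')
  · have e := hy.conf_eq hs.1 hsy h'.1.1 (by rintro rfl; exact h'.1.not_inner hy.1)
    have := hs.2.1
    have := h'.1.2.1
    rw [e] at *
    omega
  · obtain ⟨z, hz, hzy, -, hzs, -⟩ := h'.2.2.2.exists_ne hy.1
    exact hzs s hs (hy.conf_eq hz hzy hs.1 hsy)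
  · obtain ⟨x', hx'⟩ := h'.2.1
    have := hy.1.no_child hs.1 hsy h'.1.symm
    have := hx'.1.dep
    omega

/-- Both demands would have the same target, giving a triangle of conflicts. -/
theorem Demanding.not_demanding {x y : V} (h : S.Demanding x) (hM : S.Matched x y) :
    ¬ S.Demanding y := by
  obtain ⟨-, ⟨s, hs⟩, -⟩ := h
  rintro ⟨-, ⟨s', hs'⟩, -⟩
  obtain rfl := hs.unique hs' hM.1.2.2
  exact S.triangle _ _ _ hM.1.1 hs'.1 hs.1

/-- The link would make `s` the grandparent of a matched vertex, but such a vertex has two children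
and no room for the conflict with `x`. -/
theorem Demand.not_levelLink {x s y u : V} (h : S.Demand x s)
    (hxy : S.par (S.par x) = S.par (S.par y)) : ¬ S.LevelLink y u := by
  intro h'
  obtain ⟨w, hw⟩ := h'.2.2.1
  have := hw.1.dep
  have := dep_pars (S := S) u
  rcases h.child_cases (v := S.par (S.par u))
    (by rw [← h'.1.2.2.1, ← hxy, h.2.2.1]) (by omega) with e | e
  · exact hw.1.not_conf_grandpar (e ▸ S.symm _ _ h.1)
  · exact h'.1.2.2.2 (hxy.symm.trans e.symm)

/-- In a matched pair whose first vertex has a demand and whose second vertex is the parent of a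
stacked vertex, the source of the demand has a child. -/
theorem Demand.exists_child_of_stacked {x s y u w : V} (h : S.Demand x s) (hM : S.Matched x y)
    (hS : S.Stacked u y) (hM' : S.Matched u w) : ∃ k, S.par k = s ∧ S.dep k ≠ 0 := by
  obtain ⟨k, h1, h2, -⟩ := hS.2.2.2.exists_child hM'.1 (s := s)
    (by rw [← hS.1, ← hM.1.2.2, h.2.2.1]) h.dep.2 (by
      rw [← hS.1, ← hM.1.2.2]; exact h.2.2.2.symm)
  exact ⟨k, h1, h2⟩

/-- Level links are impossible here, and a stacked link in either direction makes `w` or `x` a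
gadget end. -/
theorem Demanding.not_demanding_of_link {x y u w : V} (h : S.Demanding x) (hM : S.Matched x y)
    (hL : S.Link y u) (hM' : S.Matched u w) : ¬ S.Demanding w := by
  obtain ⟨-, ⟨s, hs⟩, hG⟩ := h
  rintro ⟨-, ⟨s', hs'⟩, hG'⟩
  rcases hL with hL | hL | hL
  · exact hs.not_levelLink hM.1.2.2 hL
  · exact hG' ⟨x, y, u, s, hs, hM, hL, hM'⟩
  · have e1 : S.par (S.par w) = S.par y := by rw [← hM'.1.2.2, hL.1]
    have e2 : s' = S.par x := by
      rcases hM.1.child_cases (v := s') (by rw [← hs'.2.2.1, e1, hM.1.2.2]) hs'.dep.2 with e | e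
      · exact e
      · exact absurd (e1.trans e.symm) hs'.2.2.2
    subst e2
    exact hG ⟨w, u, y, _, hs', hM'.symm, hL, hM.symm⟩

/-- A demanding vertex has no link, so its component is an alternating path starting there; this
bounds the path by six vertices and excludes a second demand at the sixth. -/
theorem Demanding.chain_end {x y u w a c : V} (h : S.Demanding x) (hM : S.Matched x y)
    (hL : S.Link y u) (hM' : S.Matched u w) (hL' : S.Link w a) (hM'' : S.Matched a c) :
    ¬ S.Demanding c ∧ ∀ v, ¬ S.Link c v := by
  obtain ⟨-, ⟨s, hs⟩, hG⟩ := h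
  have hsy := hs.ne_inner hM.1
  rcases hL with hL | hL | hL
  · exact absurd hL (hs.not_levelLink hM.1.2.2)
  · have hg : S.Gadget x y u w s := ⟨hs, hM, hL, hM'⟩
    have hp := hg.par_end
    have hd := hg.dep
    exfalso
    rcases hL' with hL' | hL' | hL'
    · exact hL'.2.2.2.1 ⟨_, _, _, _, hg⟩
    · have e : a = s := hL'.1.trans hp
      subst e
      have e := S.deg_kcc a w c x hp (by omega) (by omega) hM''.1.1 (S.symm _ _ hs.1)
      have := hM''.1.2.1
      rw [e] at this
      omega
    · exact hM''.1.not_conf_grandpar (z := x) (by rw [← hL'.1, hp]; exact S.symm _ _ hs.1)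
  -- In this case `y` is the parent of `u`, the source `s` has a child `k`, and `x` is a leaf.
  · obtain ⟨k, hk, hkd⟩ := hs.exists_child_of_stacked hM hL hM'
    have hsd := hs.dep
    have hxd := hM.1.2.1
    have hud := hM'.1.dep
    have hwd := hM'.1.2.1
    have had := hM''.1.dep
    have hcd := hM''.1.2.1
    have dx := dep_pars (S := S) x
    have dy := dep_pars (S := S) y
    have du := dep_pars (S := S) u
    have dw := dep_pars (S := S) w
    have da := dep_pars (S := S) a
    have dc := dep_pars (S := S) c
    have hyu : S.dep y = S.dep u - 1 := by rw [hL.1]; omega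
    have e1 : S.par (S.par w) = S.par y := by rw [← hM'.1.2.2, hL.1]
    have hleaf : ∀ v, S.par v = x → S.dep v = 0 := fun v hv => hM.1.no_child hs.1 hsy hv
    rcases hL' with hL' | hL' | hL'
    · exfalso
      have e2 : S.par (S.par a) = S.par x := by
        rcases hM.1.child_cases (v := S.par (S.par a))
          (by rw [← hL'.1.2.2.1, e1, hM.1.2.2]) (by omega) with e | e
        · exact e
        · exact absurd (e1.trans e.symm) hL'.1.2.2.2
      rcases hM''.1.child_cases (v := x) e2.symm (by omega) with e | e
      · have := hleaf a e.symm
        omega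
      · have := hleaf c e.symm
        omega
    · have hal : a = S.par w := hL'.1
      have e2 : S.par (S.par c) = S.par (S.par x) := by
        rw [← hM''.1.2.2, hal, e1, hM.1.2.2]
      have e3 : S.par c = S.par x := by
        rcases hM.1.child_cases (v := S.par c) e2 (by omega) with e | e
        · exact e
        · exact absurd (by rw [e, hal, e1]) hM''.1.par_ne
      have hcx : c ≠ x := by
        rintro rfl
        have := hM.unique hM''.symm
        exact hM'.1.par_ne (by rw [← hal, ← this, hL.1])
      refine ⟨?_, ?_⟩
      · rintro ⟨-, ⟨s', hs'⟩, -⟩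
        obtain rfl := hs.unique hs' e2.symm
        exact hcx (S.deg_kcc s k c x hk hkd hsd.2 (S.symm _ _ hs'.1) (S.symm _ _ hs.1))
      · rintro v (hv | hv | hv)
        · exact hs.not_levelLink e2.symm hv
        · obtain ⟨w', hw'⟩ := hv.2.2.1
          exact hcx (S.deg_kkc v c x w' hv.1.symm (by rw [hv.1, e3]) (by omega) (by omega) hw'.1.1)
        · obtain ⟨v', hv'⟩ := hv.2.1
          have h1 := hv'.1.dep
          have h2 := hv'.1.2.1
          rcases hv'.1.child_cases (v := x) (by rw [← hv.1, e3]) (by omega) with e | e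
          · exact hcx (hv.1.trans e.symm)
          · have := hleaf v' e.symm
            omega
    · have haw : w = S.par a := hL'.1
      have hwa : S.dep w = S.dep a - 1 := by rw [haw]; omega
      have hyx : S.Conf y x := S.symm _ _ hM.1.1
      have e2 : S.par (S.par c) = S.par w := by rw [← hM''.1.2.2, haw]
      have kid_y : ∀ v, S.par v = y → S.dep v ≠ 0 → v = u := fun v hv hd =>
        S.deg_kkc y v u x hv hL.1.symm hd (by omega) hyx
      have gp_y : ∀ v, S.par v = S.par y → S.dep v ≠ 0 → v ≠ S.par w → v = y := by
        intro v hv hd hne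
        rcases hM'.1.child_cases (v := v) (by rw [hv, hL.1]) hd with e | e
        · rw [e, hL.1]
        · exact absurd e hne
      refine ⟨?_, ?_⟩
      · rintro ⟨-, ⟨s', hs'⟩, -⟩
        have e3 : s' = y := gp_y _ (by rw [← hs'.2.2.1, e2, e1]) hs'.dep.2
          (fun e => hs'.2.2.2 (e2.trans e.symm))
        subst e3
        have e4 := hM.symm.not_matched_of_child hL.1.symm (by omega) (S.symm _ _ hs'.1)
        have := hs'.2.1
        rw [e4] at this
        omega
      · rintro v (hv | hv | hv)
        · obtain ⟨v', hv'⟩ := hv.2.2.1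
          have := hv'.1.dep
          have dv := dep_pars (S := S) v
          have e3 : S.par (S.par v) = y := gp_y _ (by rw [← hv.1.2.2.1, e2, e1]) (by omega)
            (fun e => hv.1.2.2.2 (e2.trans e.symm))
          exact hv'.1.not_conf_grandpar (z := x) (by rw [e3]; exact hyx)
        · obtain ⟨v', hv'⟩ := hv.2.2.1
          have h1 := hv'.1.dep
          have h2 := hv'.1.2.1
          have dv := dep_pars (S := S) v'
          have e3 : S.par v' = y := gp_y _ (by rw [← hv'.1.2.2, hv.1, e2, e1]) (by omega)
            (fun e => hv'.1.par_ne (by rw [e, hv.1, e2]))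
          obtain rfl := kid_y v' e3 (by omega)
          have e4 := hv'.symm.unique hM'
          exact hM''.1.par_ne (by rw [← haw, ← e4, hv.1])
        · obtain ⟨v', hv'⟩ := hv.2.1
          have h1 := hv'.1.dep
          have dv := dep_pars (S := S) v
          have hcv : c = S.par v := hv.1
          have hcvd : S.dep c = S.dep v - 1 := by rw [hcv]; omega
          obtain ⟨k', hk1, hk2, z, hz, -, hkz⟩ := hv.2.2.2.exists_child hv'.1 (s := y)
            (by rw [← hcv, e2, e1]) (by omega) (by
              rw [← hcv, e2]
              intro e
              exact hM'.1.par_ne (by rw [← e, hL.1]))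
          obtain rfl := kid_y k' hk1 hk2
          obtain ⟨z', hz', hzw, -, -, -, -, hzd, -⟩ := hL.2.2.2.exists_ne hM'.1
          -- The only child of `y` is `k'`, which is a leaf because of its own long conflict. Hence
          -- `z = k'`, and that long conflict would go to the deeper vertex `v`, contrary to `hzd`.
          by_cases e : k' = z
          · subst e
            have e5 := hM'.conf_eq hz' hzw (S.symm _ _ hz) (by rintro rfl; omega)
            rw [e5] at hzd
            omega
          · obtain ⟨k'', hk1', hk2', -⟩ := Anc.exists_child S hkz e
            exact hk2' (hM'.1.no_child hz' hzw hk1')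

theorem exists_bits (S : ConflictTree V) : ∃ b : V → Prop,
    (∀ x y, S.Matched x y → (b y ↔ ¬ b x)) ∧ (∀ x y, S.Link x y → (b y ↔ ¬ b x)) ∧
      ∀ x, S.Demanding x → ¬ b x := by
  -- `C x` lists the path from `x`, which has at most six vertices.
  let C : V → V → Prop := fun x v => v = x ∨ S.Matched x v ∨ (∃ y, S.Matched x y ∧ S.Link y v) ∨
    (∃ y u, S.Matched x y ∧ S.Link y u ∧ S.Matched u v) ∨
    (∃ y u w, S.Matched x y ∧ S.Link y u ∧ S.Matched u w ∧ S.Link w v) ∨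
    (∃ y u w a, S.Matched x y ∧ S.Link y u ∧ S.Matched u w ∧ S.Link w a ∧ S.Matched a v)
  refine exists_bool_of_matchings_of_demand S.Matched S.Link S.Demanding
    (fun _ _ h => h.symm) (fun _ _ _ h h' => h.unique h') (fun _ h => h.1.1.ne rfl)
    (fun _ _ h => h.symm) (fun _ _ _ h h' => h.unique h') (fun _ h => h.ne rfl) C ?_ ?_
    (fun _ _ => Or.inl rfl) ?_
  · rintro x v w hx (rfl | h | ⟨y, h1, h2⟩ | ⟨y, u, h1, h2, h3⟩ | ⟨y, u, a, h1, h2, h3, h4⟩ |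
      ⟨y, u, a, c, h1, h2, h3, h4, h5⟩) hvw
    · exact Or.inr (Or.inl hvw)
    · exact Or.inl (h.symm.unique hvw).symm
    · exact Or.inr (Or.inr (Or.inr (Or.inl ⟨y, v, h1, h2, hvw⟩)))
    · rw [← h3.symm.unique hvw]
      exact Or.inr (Or.inr (Or.inl ⟨y, h1, h2⟩))
    · exact Or.inr (Or.inr (Or.inr (Or.inr (Or.inr ⟨y, u, a, v, h1, h2, h3, h4, hvw⟩))))
    · rw [← h5.symm.unique hvw]
      exact Or.inr (Or.inr (Or.inr (Or.inr (Or.inl ⟨y, u, a, h1, h2, h3, h4⟩))))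
  · rintro x v w hx (rfl | h | ⟨y, h1, h2⟩ | ⟨y, u, h1, h2, h3⟩ | ⟨y, u, a, h1, h2, h3, h4⟩ |
      ⟨y, u, a, c, h1, h2, h3, h4, h5⟩) hvw
    · exact absurd hvw hx.not_link
    · exact Or.inr (Or.inr (Or.inl ⟨v, h, hvw⟩))
    · rw [← h2.symm.unique hvw]
      exact Or.inr (Or.inl h1)
    · exact Or.inr (Or.inr (Or.inr (Or.inr (Or.inl ⟨y, u, v, h1, h2, h3, hvw⟩))))
    · rw [← h4.symm.unique hvw]
      exact Or.inr (Or.inr (Or.inr (Or.inl ⟨y, u, h1, h2, h3⟩)))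
    · exact absurd hvw ((hx.chain_end h1 h2 h3 h4 h5).2 w)
  · rintro x v hx hv (rfl | h | ⟨y, h1, h2⟩ | ⟨y, u, h1, h2, h3⟩ | ⟨y, u, a, h1, h2, h3, h4⟩ |
      ⟨y, u, a, c, h1, h2, h3, h4, h5⟩)
    · rfl
    · exact absurd hv (hx.not_demanding h)
    · exact absurd h2.symm hv.not_link
    · exact absurd hv (hx.not_demanding_of_link h1 h2 h3)
    · exact absurd h4.symm hv.not_link
    · exact absurd hv (hx.chain_end h1 h2 h3 h4 h5).1

end ConflictTree

/-! ### The choice of sign reversals and the local conditions they satisfy. -/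

namespace ConflictTree

variable {V : Type*} {S : ConflictTree V}

theorem Double.no_child {v a : V} (h : S.Double v) (ha : S.par a = v) : S.dep a = 0 := by
  obtain ⟨x, y, hxy, hx, hy⟩ := h
  exact hx.no_child hy.1 hxy.symm ha

theorem Double.inner {x z : V} (h : S.Double x) (hz : S.Conf x z) : S.Inner x z := by
  obtain ⟨a, b, hab, ha, hb⟩ := h
  rcases S.deg_ccc x a b z (by have := ha.dep; omega) ha.1 hb.1 hz with e | e | e
  · exact absurd e hab
  · exact e ▸ ha
  · exact e ▸ hb

/-- The other conflict of a doubly conflicting vertex provides a sibling. -/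
theorem Inner.exists_sibling {x y : V} (h : S.Inner x y) (hy : S.Double y) :
    ∃ k, k ≠ x ∧ S.par k = S.par x ∧ S.dep k ≠ 0 ∧ S.Inner k y := by
  have key : ∀ k, k ≠ x → S.Inner y k →
      ∃ k, k ≠ x ∧ S.par k = S.par x ∧ S.dep k ≠ 0 ∧ S.Inner k y := by
    intro k hk hi
    have := hi.symm.dep
    have := dep_pars (S := S) k
    refine ⟨k, hk, ?_, by omega, hi.symm⟩
    rcases h.child_cases (v := S.par k) (by rw [← hi.2.2, h.2.2]) (by omega) with e | e
    · exact e
    · exact absurd e.symm hi.par_ne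
  obtain ⟨a, b, hab, ha, hb⟩ := hy
  by_cases e : a = x
  · exact key b (by rw [← e]; exact hab.symm) hb
  · exact key a e ha

theorem Inner.matched_of_not_double {x y : V} (h : S.Inner x y) (hx : ¬ S.Double x)
    (hy : ¬ S.Double y) : S.Matched x y := by
  refine ⟨h, fun z hz => ?_, fun z hz => ?_⟩
  · by_contra hne
    exact hx ⟨z, y, hne, hz, h⟩
  · by_contra hne
    exact hy ⟨z, x, hne, hz, h.symm⟩

/-- The only candidates for `k` are the closest common ancestor of `x` and `y`, which has no
conflict, and `s`, whose child `w` leaves room only for the conflict with `x`. -/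
theorem Gadget.not_inner_child {x y u w s k r : V} (h : S.Gadget x y u w s)
    (hk : S.par k = S.par s) (hd : S.dep k ≠ 0) : ¬ S.Inner k r := by
  intro hi
  have hp := h.par_end
  have hdep := h.dep
  obtain ⟨hD, hM, hS, hM'⟩ := h
  rcases hM'.1.child_cases (v := k) (by rw [hk, ← hp, hM'.1.2.2]) hd with e | e
  · exact hM.1.not_conf_grandpar (z := r) (by rw [hM.1.2.2, ← hS.1, ← e]; exact hi.1)
  · obtain rfl : k = s := e.trans hp
    have e := S.deg_kcc k w r x hp (by omega) hd hi.1 (S.symm _ _ hD.1)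
    have := hi.2.1
    rw [e] at this
    omega

variable [LinearOrder V] (S) in
/-- The orientation of a four-cycle of conflicts on the grandchildren of a vertex is broken at the
smaller of their two parents. -/
def Flipped (u : V) : Prop :=
  ∃ v v', S.Inner v v' ∧ S.Double v ∧ S.Double v' ∧ S.par v = u ∧ S.par v < S.par v'

variable [LinearOrder V] (S) in
/-- The sign changes at the target of the demand of a gadget if the end of the gadget has another
conflict that its own bit cannot serve. -/
def SourceFlip (v : V) : Prop :=
  ∃ x y u w, S.Gadget x y u w v ∧
    ((∃ z, S.Level w z ∧ (S.GadgetEnd z → w < z)) ∨ ∃ z, S.Demand w z)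

variable (S) in
/-- The sign changes at the target of a demand of the end of a gadget. -/
def TargetFlip (v : V) : Prop := ∃ w, S.GadgetEnd w ∧ S.Demand w v

variable [LinearOrder V] (S) in
/-- The vertices at which the colour step along the tree changes its sign. -/
def Bit (b : V → Prop) (v : V) : Prop :=
  S.Double v ∨ S.Flipped v ∨ ((∃ y, S.Matched v y) ∧ b v) ∨ S.SourceFlip v ∨ S.TargetFlip v

theorem TargetFlip.spec {v : V} (h : S.TargetFlip v) : ∃ k x, S.par k = v ∧ S.dep k ≠ 0 ∧
    S.Conf v x ∧ S.dep x = S.dep v + 2 ∧ S.dep v ≠ 0 := by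
  obtain ⟨w, ⟨x, y, u, s, hg⟩, hD⟩ := h
  obtain ⟨k, hk, hkd⟩ := hg.swap_end hD
  exact ⟨k, w, hk, hkd, S.symm _ _ hD.1, hD.2.1, hD.dep.2⟩

theorem Matched.not_targetFlip {z z' : V} (h : S.Matched z z') : ¬ S.TargetFlip (S.par z) := by
  rintro ⟨w, ⟨x, y, u, s, hg⟩, hD⟩
  have hd := h.1.dep
  have hd' := h.1.symm.dep
  have := dep_pars (S := S) z'
  rcases hD.child_cases (v := S.par z') h.1.2.2.symm (by omega) with e | e
  · exact h.1.par_ne e.symm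
  · exact hg.not_inner_child (k := z') (by rw [e, hg.par_end]) (by omega) h.1.symm

variable [LinearOrder V]

theorem Flipped.spec {u : V} (h : S.Flipped u) : ∃ v v' k, S.Double v ∧ S.Double v' ∧
    S.par v = u ∧ S.dep v ≠ 0 ∧ k ≠ v ∧ S.par k = u ∧ S.dep k ≠ 0 ∧ S.Inner v v' ∧ S.Inner k v' := by
  obtain ⟨v, v', hi, hv, hv', rfl, -⟩ := h
  obtain ⟨k, h1, h2, h3, h4⟩ := hi.exists_sibling hv'
  exact ⟨v, v', k, hv, hv', rfl, by have := hi.dep; omega, h1, h2, h3, hi, h4⟩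

theorem Flipped.not_conf {u y : V} (h : S.Flipped u) : ¬ S.Conf u y := by
  obtain ⟨v, v', k, -, -, h1, h2, h3, h4, h5, -⟩ := h.spec
  exact fun hc => h3 (S.deg_kkc u k v y h4 h1 h5 h2 hc)

theorem Inner.par_lt_of_flipped {x y : V} (h : S.Inner x y) (hf : S.Flipped (S.par x)) :
    S.par x < S.par y := by
  obtain ⟨v, v', hi, -, -, e, hlt⟩ := hf
  have := hi.symm.dep
  have := dep_pars (S := S) v'
  rcases h.child_cases (v := S.par v') (by rw [← hi.2.2, e]) (by omega) with e' | e'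
  · exact absurd (e.trans e'.symm) hi.par_ne
  · rwa [e, e'] at hlt

theorem Matched.not_flipped {x y : V} (h : S.Matched x y) : ¬ S.Flipped (S.par x) := by
  intro hf
  obtain ⟨v, v', k, -, hv', h1, h2, h3, h4, h5, h6, h7⟩ := hf.spec
  have hx : S.Inner x v' := by
    rcases S.deg_kkk x v k h1.symm h4.symm (by have := h.1.dep; omega) h2 h5 with e | e | e
    · exact e ▸ h6
    · exact e ▸ h7
    · exact absurd e.symm h3
  obtain rfl := h.2.1 _ hx
  exact h.symm.not_double hv'

theorem SourceFlip.spec {v : V} (h : S.SourceFlip v) : ∃ k x, S.par k = v ∧ S.dep k ≠ 0 ∧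
    S.Conf v x ∧ S.dep x = S.dep v + 2 ∧ S.dep v ≠ 0 := by
  obtain ⟨x, y, u, w, hg, -⟩ := h
  have := hg.dep
  exact ⟨w, x, hg.par_end, by omega, S.symm _ _ hg.1.1, hg.1.2.1, by omega⟩

theorem SourceFlip.child {z : V} (h : S.SourceFlip (S.par z)) (hz : S.dep z ≠ 0) :
    S.GadgetEnd z ∧ ((∃ t, S.Level z t ∧ (S.GadgetEnd t → z < t)) ∨ ∃ t, S.Demand z t) := by
  obtain ⟨x, y, u, w, hg, h'⟩ := h
  have := hg.dep
  obtain rfl : w = z :=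
    S.deg_kkc _ w z x hg.par_end rfl (by omega) hz (S.symm _ _ hg.1.1)
  exact ⟨⟨x, y, u, _, hg⟩, h'⟩

variable {b : V → Prop}

/-- A flipped vertex has no conflict, and the other two kinds of added reversal sit at vertices with
a child whose single conflict is two levels deeper. -/
theorem Bit.conf {x z : V} (h : S.Bit b x) (hz : S.Conf x z) (hd : S.dep z ≤ S.dep x) :
    S.Double x ∨ (∃ y, S.Matched x y) ∧ b x := by
  have key : ¬ ∃ k x', S.par k = x ∧ S.dep k ≠ 0 ∧ S.Conf x x' ∧ S.dep x' = S.dep x + 2 ∧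
      S.dep x ≠ 0 := by
    rintro ⟨k, x', h1, h2, h3, h4, h5⟩
    obtain rfl := S.deg_kcc x k z x' h1 h2 h5 hz h3
    omega
  rcases h with h | h | h | h | h
  · exact Or.inl h
  · exact absurd hz h.not_conf
  · exact Or.inr h
  · exact absurd h.spec key
  · exact absurd h.spec key

theorem Bit.flipped {v : V} (h : S.Bit b v) (hv : ∀ z, ¬ S.Conf v z) : S.Flipped v := by
  rcases h with h | h | h | h | h
  · obtain ⟨a, -, -, ha, -⟩ := h
    exact absurd ha.1 (hv _)
  · exact h
  · obtain ⟨⟨a, ha⟩, -⟩ := h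
    exact absurd ha.1.1 (hv _)
  · obtain ⟨k, x, -, -, hx, -⟩ := h.spec
    exact absurd hx (hv _)
  · obtain ⟨k, x, -, -, hx, -⟩ := h.spec
    exact absurd hx (hv _)

/-- Without conflicts the vertex could only be `Flipped`, but then it would have a doubly
conflicting child, which is a leaf. -/
theorem Inner.not_bit_grandpar {x y : V} (h : S.Inner x y) : ¬ S.Bit b (S.par (S.par x)) := by
  intro hb
  obtain ⟨v, v', k, hv, -, h1, h2, -⟩ := (hb.flipped fun z => h.not_conf_grandpar).spec
  have := h.dep
  have := h.2.1
  rcases h.child_cases h1 h2 with e | e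
  · have := hv.no_child e.symm
    omega
  · have := hv.no_child e.symm
    omega

theorem Matched.bit_par {x x' : V} (h : S.Matched x x') (hb : S.Bit b (S.par x)) :
    ((∃ y, S.Matched (S.par x) y) ∧ b (S.par x)) ∨ S.SourceFlip (S.par x) := by
  rcases hb with hb | hb | hb | hb | hb
  · have := hb.no_child rfl
    have := h.1.dep
    omega
  · exact absurd hb h.not_flipped
  · exact Or.inl hb
  · exact Or.inr hb
  · exact absurd hb h.not_targetFlip

theorem Matched.bit_iff {x y : V} (h : S.Matched x y) : S.Bit b x ↔ b x := by
  constructor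
  · intro hb
    rcases hb.conf h.1.1 h.1.2.1.symm.le with h' | h'
    · exact absurd h' h.not_double
    · exact h'.2
  · exact fun hb => Or.inr (Or.inr (Or.inl ⟨⟨y, h⟩, hb⟩))

theorem Inner.bit_par_iff {x y : V} (h : S.Inner x y) (hx : S.Double x) (hy : S.Double y) :
    S.Bit b (S.par x) ↔ S.par x < S.par y := by
  constructor
  · intro hb
    obtain ⟨k, h1, h2, h3, -⟩ := h.exists_sibling hy
    refine h.par_lt_of_flipped (hb.flipped fun z hz => h1 ?_)
    exact S.deg_kkc _ k x z h2 rfl h3 (by have := h.dep; omega) hz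
  · exact fun hlt => Or.inr (Or.inl ⟨x, y, h, hx, hy, rfl, hlt⟩)

theorem Inner.bit_of_double {x y : V} (h : S.Inner x y) (hx : S.Double x) (hy : ¬ S.Double y) :
    S.Bit b x ∧ ¬ S.Bit b y := by
  refine ⟨Or.inl hx, fun hb => ?_⟩
  rcases hb.conf h.symm.1 h.2.1.le with h' | ⟨⟨y', h'⟩, -⟩
  · exact hy h'
  · obtain rfl := h'.2.1 _ h.symm
    exact h'.symm.not_double hx

/-- Two double ends both reverse, so their parents must differ; `Flipped` reverses at the smaller
parent only. One double end is the only end that reverses, and with no double end the pair is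
matched. -/
theorem Inner.bit {x y : V} (hM : ∀ x y, S.Matched x y → (b y ↔ ¬ b x)) (h : S.Inner x y) :
    ¬ (S.Bit b x ↔ S.Bit b y) ∨
      (¬ (S.Bit b (S.par x) ↔ S.Bit b (S.par y)) ∧ (S.Bit b x ∨ S.Bit b y)) := by
  by_cases hx : S.Double x
  · by_cases hy : S.Double y
    · refine Or.inr ⟨?_, Or.inl (Or.inl hx)⟩
      rw [h.bit_par_iff hx hy, h.symm.bit_par_iff hy hx]
      rcases lt_trichotomy (S.par x) (S.par y) with e | e | e
      · exact fun hh => lt_asymm e (hh.1 e)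
      · exact absurd e h.par_ne
      · exact fun hh => lt_asymm e (hh.2 e)
    · have := h.bit_of_double (b := b) hx hy
      tauto
  · by_cases hy : S.Double y
    · have := h.symm.bit_of_double (b := b) hy hx
      tauto
    · have hm := h.matched_of_not_double hx hy
      rw [hm.bit_iff, hm.symm.bit_iff, hM x y hm]
      tauto

/-- A gadget end may carry a bit: then `SourceFlip` acts at its parent and `TargetFlip` at `s`,
while its grandparent carries none. -/
theorem Demand.bit {x s : V} (hD : ∀ x, S.Demanding x → ¬ b x) (h : S.Demand x s) :
    ¬ S.Bit b x ∨ (S.Bit b (S.par x) ∧ ¬ (S.Bit b s ↔ S.Bit b (S.par (S.par x)))) := by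
  by_cases hx : S.Bit b x
  · right
    rcases hx.conf h.1 (by have := h.2.1; omega) with h' | ⟨⟨y, hy⟩, hbx⟩
    · exact absurd h' h.not_double
    · by_cases hG : S.GadgetEnd x
      · have h1 := hy.1.not_bit_grandpar (b := b)
        have h2 : S.Bit b s := Or.inr (Or.inr (Or.inr (Or.inr ⟨x, hG, h⟩)))
        obtain ⟨x', y', u', s', hg⟩ := hG
        obtain rfl := hg.par_end
        exact ⟨Or.inr (Or.inr (Or.inr (Or.inl ⟨x', y', u', x, hg, Or.inr ⟨s, h⟩⟩))), by tauto⟩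
      · exact absurd hbx (hD x ⟨⟨y, hy⟩, ⟨s, h⟩, hG⟩)
  · exact Or.inl hx

theorem Level.bit_par_iff {x z : V} (h : S.Level x z) (hG : S.GadgetEnd x) :
    S.Bit b (S.par x) ↔ (S.GadgetEnd z → x < z) := by
  obtain ⟨x', y, u, s, hg⟩ := hG
  obtain rfl := hg.par_end
  have hdep := hg.dep
  constructor
  · intro hb
    rcases hg.2.2.2.symm.bit_par hb with ⟨⟨r, hr⟩, -⟩ | hb
    · have e := hr.not_matched_of_child (a := x) rfl (by omega) (S.symm _ _ hg.1.1)
      have := hr.1.2.1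
      rw [← e] at this
      omega
    · have hne : z ≠ u := by rintro rfl; exact h.not_inner hg.2.2.2.symm.1
      obtain ⟨-, ⟨t, ht, hlt⟩ | ⟨t, ht⟩⟩ := hb.child (by omega)
      · obtain rfl := hg.2.2.2.symm.conf_eq ht.1 (by
          rintro rfl; exact ht.not_inner hg.2.2.2.symm.1) h.1 hne
        exact hlt
      · obtain rfl := hg.2.2.2.symm.conf_eq ht.1 (ht.ne_inner hg.2.2.2.symm.1) h.1 hne
        have := ht.2.1
        have := h.2.1
        omega
  · exact fun hlt => Or.inr (Or.inr (Or.inr (Or.inl ⟨x', y, u, x, hg, Or.inl ⟨z, h, hlt⟩⟩)))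

theorem Level.not_bit_par {x z z' : V} (h : S.Level x z) (hG : S.GadgetEnd x)
    (hz : S.Matched z z') (hG' : ¬ S.GadgetEnd z) : ¬ S.Bit b (S.par z) := by
  intro hb
  have hzd := hz.1.dep
  rcases hz.bit_par hb with ⟨⟨r, hr⟩, -⟩ | hb
  · obtain ⟨x', y, u, s, hg⟩ := hG
    obtain rfl := hg.par_end
    have hdep := hg.dep
    have hr' := hr.1.symm.dep
    have := dep_pars (S := S) r
    have := dep_pars (S := S) x
    have := dep_pars (S := S) z
    have := hr.1.dep
    have := h.2.1
    refine hg.not_inner_child (k := r) ?_ (by omega) hr.1.symm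
    rcases S.deg_kkk (S.par r) (S.par (S.par x)) (S.par (S.par z))
      (by rw [← hr.1.2.2, h.2.2.1]) hr.1.2.2.symm (by omega) (by omega) (by omega) with e | e | e
    · exact e
    · exact absurd e.symm hr.1.par_ne
    · exact absurd e h.2.2.2
  · exact hG' (hb.child (by omega)).1

/-- When both bits are set, at least one end is a gadget end, since otherwise the link makes them
opposite. `SourceFlip` then reverses exactly one of the two parents, the order on `V` deciding
between two gadget ends. -/
theorem Level.bit {x z : V} (hL : ∀ x y, S.Link x y → (b y ↔ ¬ b x)) (h : S.Level x z) :
    ¬ (S.Bit b x ∧ S.Bit b z) ∨ ((S.Bit b (S.par (S.par x)) ↔ S.Bit b (S.par (S.par z))) ∧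
      ¬ (S.Bit b (S.par x) ↔ S.Bit b (S.par z))) := by
  by_cases hxz : S.Bit b x ∧ S.Bit b z
  · right
    obtain ⟨hx, hz⟩ := hxz
    rcases hx.conf h.1 h.2.1.symm.le with h' | ⟨⟨x', hx'⟩, hbx⟩
    · exact absurd (h'.inner h.1) h.not_inner
    rcases hz.conf h.symm.1 h.2.1.le with h' | ⟨⟨z', hz'⟩, hbz⟩
    · exact absurd (h'.inner h.symm.1) h.symm.not_inner
    have h1 := hx'.1.not_bit_grandpar (b := b)
    have h2 := hz'.1.not_bit_grandpar (b := b)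
    refine ⟨by tauto, ?_⟩
    by_cases hGx : S.GadgetEnd x
    · by_cases hGz : S.GadgetEnd z
      · rw [h.bit_par_iff hGx, h.symm.bit_par_iff hGz]
        rcases lt_trichotomy x z with e | e | e
        · exact fun hh => lt_asymm e (hh.1 (fun _ => e) hGx)
        · exact absurd e h.1.ne
        · exact fun hh => lt_asymm e (hh.2 (fun _ => e) hGz)
      · have h3 := h.not_bit_par (b := b) hGx hz' hGz
        rw [h.bit_par_iff hGx]
        tauto
    · by_cases hGz : S.GadgetEnd z
      · have h3 := h.symm.not_bit_par (b := b) hGz hx' hGx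
        rw [h.symm.bit_par_iff hGz]
        tauto
      · exact absurd hbx ((hL x z (Or.inl ⟨h, ⟨x', hx'⟩, ⟨z', hz'⟩, hGx, hGz⟩)).1 hbz)
  · exact Or.inl hxz

/-- If `x` and its parent both reverse, the grandparent does not. When the path ends at the fourth
ancestor, the conflict is long and the stacked link makes the two bits opposite, so they cannot both
be set. -/
theorem Bit.of_not_anc {x z : V} (hL : ∀ x y, S.Link x y → (b y ↔ ¬ b x)) (h : S.Conf x z)
    (hd : S.dep z ≤ S.dep x) (hA : ¬ S.Anc (S.par (S.par (S.par x))) z) :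
    ¬ S.Bit b x ∨ ¬ S.Bit b (S.par x) ∨
      (¬ S.Anc (S.par (S.par (S.par (S.par x)))) z ∧ ¬ S.Bit b (S.par (S.par x))) := by
  by_cases hx : S.Bit b x
  swap
  · exact Or.inl hx
  by_cases hu : S.Bit b (S.par x)
  swap
  · exact Or.inr (Or.inl hu)
  refine Or.inr (Or.inr ?_)
  rcases hx.conf h hd with h' | ⟨⟨x', hx'⟩, hbx⟩
  · have hi := h'.inner h
    have := hi.symm.dep
    have := dep_pars (S := S) z
    refine absurd (.step _ (by omega) (.step _ (by omega) (.step _ (by omega) ?_))) hA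
    rw [hi.2.2]
    exact .refl
  refine ⟨fun hA' => ?_, hx'.1.not_bit_grandpar⟩
  have hF : S.LongFour x := ⟨z, h, hA', hA, hd⟩
  rcases hx'.bit_par hu with ⟨hw, hbu⟩ | hu
  · exact (hL x (S.par x) (Or.inr (Or.inl ⟨rfl, ⟨x', hx'⟩, hw, hF⟩))).1 hbu hbx
  · obtain ⟨t, ht, htx, htL, htD, -⟩ := hF.exists_ne hx'.1
    obtain ⟨-, ⟨t', ht', -⟩ | ⟨t', ht'⟩⟩ := hu.child (by have := hx'.1.dep; omega)
    · obtain rfl := hx'.conf_eq ht htx ht'.1 (by rintro rfl; exact ht'.not_inner hx'.1)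
      exact htL ht'
    · exact htD t' ht' (hx'.conf_eq ht htx ht'.1 (ht'.ne_inner hx'.1))

end ConflictTree

/-! ### From sign reversals to a three-colouring of the tree edges. -/

namespace ConflictTree

variable {V : Type*} (S : ConflictTree V)

open Classical in
/-- The sign of the colour step at a vertex: it is inherited from the parent, and changed where
`β` holds. -/
noncomputable def sign (β : V → Prop) (v : V) : ZMod 3 :=
  if _h : S.dep v = 0 then 1 else if β v then - sign β (S.par v) else sign β (S.par v)
termination_by S.dep v
decreasing_by all_goals have := S.dep_par v _h; omega

/-- The colour of the tree edge between a vertex and its parent. -/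
noncomputable def colour (β : V → Prop) (v : V) : ZMod 3 :=
  if _h : S.dep v = 0 then 0 else colour β (S.par v) + S.sign β v
termination_by S.dep v
decreasing_by have := S.dep_par v _h; omega

variable {S} {β : V → Prop}

theorem sign_of_pos {v : V} (hv : S.dep v ≠ 0) (h : β v) :
    S.sign β v = - S.sign β (S.par v) := by
  rw [sign, dif_neg hv, if_pos h]

theorem sign_of_neg {v : V} (hv : S.dep v ≠ 0) (h : ¬ β v) :
    S.sign β v = S.sign β (S.par v) := by
  rw [sign, dif_neg hv, if_neg h]

theorem sign_ne_zero (v : V) : S.sign β v ≠ 0 := by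
  induction hn : S.dep v generalizing v with
  | zero =>
    rw [sign, dif_pos hn]
    decide
  | succ n ih =>
    have := ih (S.par v) (dep_par_of_pos hn)
    by_cases h : β v
    · rw [sign_of_pos (by omega) h]
      simpa using this
    · rwa [sign_of_neg (by omega) h]

theorem colour_eq {v : V} (hv : S.dep v ≠ 0) :
    S.colour β v = S.colour β (S.par v) + S.sign β v := by
  rw [colour, dif_neg hv]

/-- Without a reversal at `v` the three colours are `c`, `c + s`, `c + 2s` with `s ≠ 0`. -/
theorem colour_run {v : V} (h : ¬ β v) (hd : 2 ≤ S.dep v) (r : ZMod 3) :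
    S.colour β v = r ∨ S.colour β (S.par v) = r ∨ S.colour β (S.par (S.par v)) = r := by
  have h1 := dep_pars (S := S) v
  have h2 := sign_ne_zero (S := S) (β := β) (S.par v)
  rw [colour_eq (v := v) (by omega), colour_eq (v := S.par v) (by omega), sign_of_neg (by omega) h]
  generalize S.sign β (S.par v) = s at *
  generalize S.colour β _ = c at *
  clear h1
  revert h2
  decide +revert

theorem Anc.par {v z : V} (h : S.Anc v z) : S.Anc (S.par v) z := by
  induction h with
  | refl =>
    by_cases hv : S.dep v = 0
    · rw [S.par_root v hv]
      exact .refl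
    · exact .step _ hv .refl
  | step x hx _ ih => exact .step _ hx ih

theorem anc_iff_zero {y z : V} (h : S.dep z = S.dep y) : S.Anc y z ↔ y = z :=
  ⟨fun h' => Anc.eq_of_dep S h' h.le, by rintro rfl; exact .refl⟩

theorem anc_iff_one {y z : V} (h : S.dep z = S.dep y + 1) : S.Anc y z ↔ y = S.par z := by
  have := dep_par_eq (S := S) z
  rw [anc_iff, anc_iff_zero (z := S.par z) (by omega)]
  constructor
  · rintro (rfl | h')
    · omega
    · exact h'.2
  · exact fun h' => Or.inr ⟨by omega, h'⟩

theorem anc_iff_two {y z : V} (h : S.dep z = S.dep y + 2) : S.Anc y z ↔ y = S.par (S.par z) := by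
  have := dep_par_eq (S := S) z
  rw [anc_iff, anc_iff_one (z := S.par z) (by omega)]
  constructor
  · rintro (rfl | h')
    · omega
    · exact h'.2
  · exact fun h' => Or.inr ⟨by omega, h'⟩

theorem anc_iff_three {y z : V} (h : S.dep z = S.dep y + 3) :
    S.Anc y z ↔ y = S.par (S.par (S.par z)) := by
  have := dep_par_eq (S := S) z
  rw [anc_iff, anc_iff_two (z := S.par z) (by omega)]
  constructor
  · rintro (rfl | h')
    · omega
    · exact h'.2
  · exact fun h' => Or.inr ⟨by omega, h'⟩

theorem anc_pars (x : V) : S.Anc (S.par x) x ∧ S.Anc (S.par (S.par x)) x ∧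
    S.Anc (S.par (S.par (S.par x))) x ∧ S.Anc (S.par (S.par (S.par (S.par x)))) x := by
  have h1 : S.Anc (S.par x) x := Anc.par .refl
  exact ⟨h1, h1.par, h1.par.par, h1.par.par.par⟩

/-- If the third ancestor of `x` lies above `z`, the depths differ by at most three, hence by zero
or two by parity. -/
theorem conf_cases {x z : V} (h : S.Conf x z) (hd : S.dep z ≤ S.dep x) :
    S.Inner x z ∨ S.Level x z ∨ S.Demand x z ∨ ¬ S.Anc (S.par (S.par (S.par x))) z := by
  by_cases hA : S.Anc (S.par (S.par (S.par x))) z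
  swap
  · exact Or.inr (Or.inr (Or.inr hA))
  have hpar := S.parity _ _ h
  have hx := dep_pars (S := S) x
  have hz := dep_pars (S := S) z
  have hAd := Anc.dep_le S hA
  have hne := Conf.ne h
  have hx3 : 3 ≤ S.dep x := by
    by_contra hlt
    have : S.dep x = 0 ∨ S.dep x = 1 ∨ S.dep x = 2 ∧ S.dep z = 2 ∨ S.dep x = 2 ∧ S.dep z = 0 := by
      omega
    rcases this with e | e | e | e
    · exact hne (S.root_unique _ _ e (by omega))
    · exact hne (S.root_child _ _ e (by omega))
    · exact S.par_ne _ _ h (S.root_child _ _ (by omega) (by omega))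
    · exact S.grandpar_ne _ _ h (S.root_unique _ _ (by omega) (by omega))
  have : S.dep z = S.dep x ∨ S.dep x = S.dep z + 2 := by omega
  rcases this with e | e
  · have e3 := (anc_iff_three (by omega)).1 hA
    by_cases e2 : S.par (S.par x) = S.par (S.par z)
    · exact Or.inl ⟨h, e.symm, e2⟩
    · exact Or.inr (Or.inl ⟨h, e.symm, e3, e2⟩)
  · exact Or.inr (Or.inr (Or.inl ⟨h, e, (anc_iff_one (by omega)).1 hA, S.grandpar_ne _ _ h⟩))

variable (S) in
/-- Every colour occurs on the tree path between `x` and `z`. -/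
def Rainbow (β : V → Prop) (x z : V) : Prop :=
  -- The edge above `v` lies on the path exactly when `v` is an ancestor of one end only; the dummy
  -- colour of the root thus never counts.
  ∀ r, ∃ v, S.colour β v = r ∧ ¬ (S.Anc v x ↔ S.Anc v z)

theorem Rainbow.symm {x z : V} (h : S.Rainbow β x z) : S.Rainbow β z x := by
  intro r
  obtain ⟨v, h1, h2⟩ := h r
  exact ⟨v, h1, fun h3 => h2 h3.symm⟩

theorem rainbow_of_run {x z v : V} (hv : ¬ β v) (hx : S.Anc v x)
    (hz : ¬ S.Anc (S.par (S.par v)) z) : S.Rainbow β x z := by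
  have hd : 2 ≤ S.dep v := by
    by_contra hlt
    have := dep_pars (S := S) v
    exact hz (S.anc_root (by omega) z)
  intro r
  rcases colour_run hv hd r with h | h | h
  · exact ⟨_, h, fun h' => hz (h'.1 hx).par.par⟩
  · exact ⟨_, h, fun h' => hz (h'.1 hx.par).par⟩
  · exact ⟨_, h, fun h' => hz (h'.1 hx.par.par)⟩

theorem rainbow_of_not_anc {x z : V} (hz : ¬ S.Anc (S.par (S.par (S.par x))) z)
    (h : ¬ β x ∨ ¬ β (S.par x) ∨
      (¬ S.Anc (S.par (S.par (S.par (S.par x)))) z ∧ ¬ β (S.par (S.par x)))) :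
    S.Rainbow β x z := by
  have ha := anc_pars (S := S) x
  rcases h with h | h | h
  · exact rainbow_of_run h .refl fun h' => hz h'.par
  · exact rainbow_of_run h ha.1 hz
  · exact rainbow_of_run h.2 ha.2.1 h.1

theorem Inner.rainbow {x z : V} (h : S.Inner x z)
    (hβ : ¬ (β x ↔ β z) ∨ (¬ (β (S.par x) ↔ β (S.par z)) ∧ (β x ∨ β z))) :
    S.Rainbow β x z := by
  intro r
  have hx := dep_pars (S := S) x
  have hz := dep_pars (S := S) z
  have hd := h.dep
  have he := h.2.1
  have ha := anc_pars (S := S) x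
  have ha' := anc_pars (S := S) z
  have n0 : ¬ S.Anc x z := by rw [anc_iff_zero he.symm]; exact Conf.ne h.1
  have n0' : ¬ S.Anc z x := by rw [anc_iff_zero he]; exact (Conf.ne h.1).symm
  have n1 : ¬ S.Anc (S.par x) z := by rw [anc_iff_one (by omega)]; exact h.par_ne
  have n1' : ¬ S.Anc (S.par z) x := by rw [anc_iff_one (by omega)]; exact h.par_ne.symm
  have key : S.colour β x = r ∨ S.colour β (S.par x) = r ∨ S.colour β z = r ∨
      S.colour β (S.par z) = r := by
    rw [colour_eq (v := x) (by omega), colour_eq (v := S.par x) (by omega),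
      colour_eq (v := z) (by omega), colour_eq (v := S.par z) (by omega), ← h.2.2]
    have s1 := sign_ne_zero (S := S) (β := β) (S.par x)
    have s1' := sign_ne_zero (S := S) (β := β) (S.par z)
    rcases hβ with hβ | ⟨hβ, hβ'⟩
    · by_cases b1 : β x
      · have b2 : ¬ β z := by tauto
        rw [sign_of_pos (v := x) (by omega) b1, sign_of_neg (v := z) (by omega) b2]
        clear * - s1 s1'
        generalize S.sign β _ = s at *
        generalize S.sign β _ = t at *
        generalize S.colour β _ = c at *
        revert s1 s1'
        decide +revert
      · have b2 : β z := by tauto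
        rw [sign_of_neg (v := x) (by omega) b1, sign_of_pos (v := z) (by omega) b2]
        clear * - s1 s1'
        generalize S.sign β _ = s at *
        generalize S.sign β _ = t at *
        generalize S.colour β _ = c at *
        revert s1 s1'
        decide +revert
    · have e : S.sign β (S.par z) = - S.sign β (S.par x) := by
        by_cases b1 : β (S.par x)
        · have b2 : ¬ β (S.par z) := by tauto
          rw [sign_of_pos (v := S.par x) (by omega) b1, sign_of_neg (v := S.par z) (by omega) b2,
            h.2.2, neg_neg]
        · have b2 : β (S.par z) := by tauto
          rw [sign_of_neg (v := S.par x) (by omega) b1, sign_of_pos (v := S.par z) (by omega) b2,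
            h.2.2]
      rcases hβ' with b1 | b1
      · rw [sign_of_pos (v := x) (by omega) b1, e]
        generalize S.sign β z = t
        clear * - s1
        generalize S.sign β _ = s at *
        generalize S.colour β _ = c at *
        revert s1
        decide +revert
      · rw [sign_of_pos (v := z) (by omega) b1, e]
        generalize S.sign β x = t
        clear * - s1
        generalize S.sign β (S.par x) = s at *
        generalize S.colour β _ = c at *
        revert s1
        decide +revert
  rcases key with e | e | e | e
  · exact ⟨_, e, fun h' => n0 (h'.1 .refl)⟩
  · exact ⟨_, e, fun h' => n1 (h'.1 ha.1)⟩
  · exact ⟨_, e, fun h' => n0' (h'.2 .refl)⟩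
  · exact ⟨_, e, fun h' => n1' (h'.2 ha'.1)⟩

theorem sign_eq_of_iff {v w : V} (h : S.par v = S.par w) (hv : S.dep v ≠ 0) (hw : S.dep w ≠ 0)
    (hβ : β v ↔ β w) : S.sign β v = S.sign β w := by
  by_cases b : β v
  · rw [sign_of_pos hv b, sign_of_pos hw (hβ.1 b), h]
  · rw [sign_of_neg hv b, sign_of_neg hw (fun b' => b (hβ.2 b')), h]

theorem sign_eq_neg {v w : V} (h : S.sign β (S.par v) = S.sign β (S.par w)) (hv : S.dep v ≠ 0)
    (hw : S.dep w ≠ 0) (hβ : ¬ (β v ↔ β w)) : S.sign β w = - S.sign β v := by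
  by_cases b : β v
  · have b' : ¬ β w := by tauto
    rw [sign_of_pos hv b, sign_of_neg hw b', h, neg_neg]
  · have b' : β w := by tauto
    rw [sign_of_neg hv b, sign_of_pos hw b', h]

theorem Level.rainbow {x z : V} (h : S.Level x z)
    (hβ : ¬ (β x ∧ β z) ∨ ((β (S.par (S.par x)) ↔ β (S.par (S.par z))) ∧
      ¬ (β (S.par x) ↔ β (S.par z)))) : S.Rainbow β x z := by
  have he := h.2.1
  have hx := dep_pars (S := S) x
  have hz := dep_pars (S := S) z
  have hd : 3 ≤ S.dep x := by
    by_contra hlt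
    exact h.2.2.2 (S.root_unique _ _ (by omega) (by omega))
  have n2 : ¬ S.Anc (S.par (S.par x)) z := by rw [anc_iff_two (by omega)]; exact h.2.2.2
  have n2' : ¬ S.Anc (S.par (S.par z)) x := by rw [anc_iff_two (by omega)]; exact h.2.2.2.symm
  by_cases b1 : β x
  swap
  · exact rainbow_of_run b1 .refl n2
  by_cases b2 : β z
  swap
  · exact (rainbow_of_run b2 .refl n2').symm
  obtain ⟨h1, h2⟩ := hβ.resolve_left (not_not.2 ⟨b1, b2⟩)
  have ha := anc_pars (S := S) x
  have ha' := anc_pars (S := S) z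
  intro r
  have e2 := sign_eq_of_iff h.2.2.1 (by omega) (by omega) h1
  have e1 := sign_eq_neg e2 (by omega) (by omega) h2
  have key : S.colour β (S.par x) = r ∨ S.colour β (S.par (S.par x)) = r ∨
      S.colour β (S.par z) = r := by
    have s1 := sign_ne_zero (S := S) (β := β) (S.par x)
    rw [colour_eq (v := S.par x) (by omega), colour_eq (v := S.par z) (by omega),
      colour_eq (v := S.par (S.par x)) (by omega), colour_eq (v := S.par (S.par z)) (by omega),
      ← e2, e1, ← h.2.2.1]
    clear * - s1
    generalize S.sign β (S.par x) = s at *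
    generalize S.sign β _ = t at *
    generalize S.colour β _ = c at *
    revert s1
    decide +revert
  rcases key with e | e | e
  · exact ⟨_, e, fun h' => n2 (h'.1 ha.1).par⟩
  · exact ⟨_, e, fun h' => n2 (h'.1 ha.2.1)⟩
  · exact ⟨_, e, fun h' => n2' (h'.2 ha'.1).par⟩

theorem Demand.rainbow {x z : V} (h : S.Demand x z)
    (hβ : ¬ β x ∨ (β (S.par x) ∧ ¬ (β z ↔ β (S.par (S.par x))))) : S.Rainbow β x z := by
  have he := h.2.1
  have hx := dep_pars (S := S) x
  have hd := h.dep
  have n2 : ¬ S.Anc (S.par (S.par x)) z := by rw [anc_iff_zero (by omega)]; exact h.2.2.2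
  have n2' : ¬ S.Anc z x := by rw [anc_iff_two (by omega)]; exact h.2.2.2.symm
  rcases hβ with b1 | ⟨b1, b2⟩
  · exact rainbow_of_run b1 .refl n2
  have ha := anc_pars (S := S) x
  intro r
  have e1 := sign_eq_neg (S := S) (by rw [h.2.2.1]) hd.2 (by omega) b2
  have key : S.colour β (S.par x) = r ∨ S.colour β (S.par (S.par x)) = r ∨
      S.colour β z = r := by
    have s1 := sign_ne_zero (S := S) (β := β) z
    rw [colour_eq (v := S.par x) (by omega), colour_eq hd.2, sign_of_pos (by omega) b1,
      colour_eq (v := S.par (S.par x)) (by omega), e1, ← h.2.2.1]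
    clear * - s1
    generalize S.sign β z = s at *
    generalize S.colour β _ = c at *
    revert s1
    decide +revert
  rcases key with e | e | e
  · exact ⟨_, e, fun h' => n2 (h'.1 ha.1).par⟩
  · exact ⟨_, e, fun h' => n2 (h'.1 ha.2.1)⟩
  · exact ⟨_, e, fun h' => n2' (h'.2 .refl)⟩

/-- The edges of the tree have a colouring with three colours such that every colour occurs on the
tree path between any two conflicting vertices. -/
theorem exists_colouring (S : ConflictTree V) : ∃ c : V → ZMod 3, ∀ x z, S.Conf x z →
    ∀ r, ∃ v, c v = r ∧ ¬ (S.Anc v x ↔ S.Anc v z) := by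
  classical
  -- Any linear order will do: it only breaks ties in `Flipped` and `SourceFlip`.
  let : LinearOrder V := linearOrderOfSTO WellOrderingRel
  obtain ⟨b, hM, hL, hD⟩ := S.exists_bits
  have key : ∀ x z, S.Conf x z → S.dep z ≤ S.dep x → S.Rainbow (S.Bit b) x z := by
    intro x z h hd
    rcases conf_cases h hd with h' | h' | h' | h'
    · exact h'.rainbow (h'.bit hM)
    · exact h'.rainbow (h'.bit hL)
    · exact h'.rainbow (h'.bit hD)
    · exact rainbow_of_not_anc h' (Bit.of_not_anc hL h hd h')
  refine ⟨S.colour (S.Bit b), fun x z h => ?_⟩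
  rcases le_total (S.dep z) (S.dep x) with hd | hd
  · exact key x z h hd
  · exact (key z x (S.symm _ _ h) hd).symm

end ConflictTree

/-! ### Spanning trees of triangle-free subcubic graphs as conflict trees. -/

namespace SimpleGraph

variable {V : Type*} {G T : SimpleGraph V}

theorem IsTree.exists_adj_dist_eq (hT : T.IsTree) {ρ v : V} (hv : v ≠ ρ) :
    ∃ u, T.Adj v u ∧ T.dist ρ v = T.dist ρ u + 1 := by
  obtain ⟨p, hp⟩ := hT.connected.exists_walk_length_eq_dist v ρ
  cases p with
  | nil => exact absurd rfl hv
  | @cons _ u _ h q =>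
    refine ⟨u, h, ?_⟩
    have h1 := T.dist_le q
    rw [Walk.length_cons] at hp
    have h2 := hT.dist_eq_dist_add_one_of_adj ρ h
    rw [T.dist_comm (u := ρ), T.dist_comm (u := ρ)] at *
    omega

theorem IsTree.eq_of_adj_of_dist_eq (hT : T.IsTree) {ρ v a b : V} (ha : T.Adj v a)
    (hb : T.Adj v b) (ha' : T.dist ρ v = T.dist ρ a + 1) (hb' : T.dist ρ v = T.dist ρ b + 1) :
    a = b := by
  obtain ⟨p, hp⟩ := hT.connected.exists_walk_length_eq_dist a ρ
  obtain ⟨q, hq⟩ := hT.connected.exists_walk_length_eq_dist b ρ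
  rw [T.dist_comm (u := ρ), T.dist_comm (u := ρ)] at ha' hb'
  have h1 : (Walk.cons ha p).IsPath := Walk.isPath_of_length_eq_dist _ (by
    rw [Walk.length_cons, hp, ha'])
  have h2 : (Walk.cons hb q).IsPath := Walk.isPath_of_length_eq_dist _ (by
    rw [Walk.length_cons, hq, hb'])
  have h3 := (hT.existsUnique_path v ρ).unique h1 h2
  have h4 := congrArg Walk.snd h3
  simpa using h4

theorem four_adj_of_maxDegree_le [Fintype V] [DecidableRel G.Adj] (hdeg : G.maxDegree ≤ 3)
    {v a b c d : V} (ha : G.Adj v a) (hb : G.Adj v b) (hc : G.Adj v c) (hd : G.Adj v d) :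
    a = b ∨ a = c ∨ a = d ∨ b = c ∨ b = d ∨ c = d := by
  classical
  by_contra! h
  have h1 : ({a, b, c, d} : Finset V) ⊆ G.neighborFinset v := by
    intro x hx
    simp only [Finset.mem_insert, Finset.mem_singleton] at hx
    rw [mem_neighborFinset]
    rcases hx with rfl | rfl | rfl | rfl <;> assumption
  have h2 := Finset.card_le_card h1
  have h3 : ({a, b, c, d} : Finset V).card = 4 := by
    rw [Finset.card_insert_of_notMem (by simp; tauto), Finset.card_insert_of_notMem (by simp; tauto),
      Finset.card_insert_of_notMem (by simp; tauto), Finset.card_singleton]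
  rw [card_neighborFinset_eq_degree] at h2
  have := G.degree_le_maxDegree v
  omega

theorem IsTree.exists_root [Fintype V] (hT : T.IsTree) :
    ∃ ρ, ∀ a b, T.Adj ρ a → T.Adj ρ b → a = b := by
  classical
  rcases subsingleton_or_nontrivial V with h | h
  · exact ⟨hT.connected.nonempty.some, fun a b _ _ => Subsingleton.elim a b⟩
  · obtain ⟨ρ, hρ⟩ := hT.exists_vert_degree_one_of_nontrivial
    rw [degree_eq_one_iff_existsUnique_adj] at hρ
    exact ⟨ρ, fun a b ha hb => hρ.unique ha hb⟩

end SimpleGraph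

open SimpleGraph in
/-- A rooted spanning tree of a triangle-free subcubic graph, with the other edges at even tree
distance as conflicts. -/
theorem exists_conflictTree {V : Type*} [Fintype V] {G T : SimpleGraph V} [DecidableRel G.Adj]
    (hfree : G.CliqueFree 3) (hdeg : G.maxDegree ≤ 3) (hTG : T ≤ G) (hT : T.IsTree) :
    ∃ S : ConflictTree V,
      (∀ u v, T.Adj u v ↔ (S.dep u ≠ 0 ∧ S.par u = v) ∨ (S.dep v ≠ 0 ∧ S.par v = u)) ∧
      ∀ u v, S.Conf u v ↔ G.Adj u v ∧ ¬ T.Adj u v ∧ S.dep u % 2 = S.dep v % 2 := by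
  classical
  obtain ⟨ρ, hρ⟩ := hT.exists_root
  have hex : ∀ v, ∃ u, (v = ρ → u = ρ) ∧ (v ≠ ρ → T.Adj v u ∧ T.dist ρ v = T.dist ρ u + 1) := by
    intro v
    by_cases hv : v = ρ
    · exact ⟨ρ, fun _ => rfl, fun h => absurd hv h⟩
    · obtain ⟨u, hu⟩ := hT.exists_adj_dist_eq hv
      exact ⟨u, fun h => absurd h hv, fun _ => hu⟩
  choose par hpar0 hpar using hex
  have hdep : ∀ v, T.dist ρ v = 0 ↔ v = ρ := fun v => by
    rw [hT.connected.dist_eq_zero_iff, eq_comm]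
  have hdep' : ∀ v, T.dist ρ v ≠ 0 → T.Adj v (par v) ∧ T.dist ρ v = T.dist ρ (par v) + 1 :=
    fun v hv => hpar v fun h => hv ((hdep v).2 h)
  have hadj : ∀ u v, T.Adj u v ↔
      (T.dist ρ u ≠ 0 ∧ par u = v) ∨ (T.dist ρ v ≠ 0 ∧ par v = u) := by
    intro u v
    constructor
    · intro h
      rcases hT.dist_eq_dist_add_one_of_adj ρ h with e | e
      · have := hdep' u (by omega)
        exact Or.inl ⟨by omega, hT.eq_of_adj_of_dist_eq this.1 h this.2 e⟩
      · have := hdep' v (by omega)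
        exact Or.inr ⟨by omega, hT.eq_of_adj_of_dist_eq this.1 h.symm this.2 e⟩
    · rintro (⟨h, rfl⟩ | ⟨h, rfl⟩)
      · exact (hdep' u h).1
      · exact (hdep' v h).1.symm
  have htri : ∀ x y z, G.Adj x y → G.Adj y z → ¬ G.Adj x z := fun x y z h1 h2 h3 =>
    hfree {x, y, z} (is3Clique_triple_iff.2 ⟨h1, h3, h2⟩)
  have kid : ∀ {a v}, par a = v → T.dist ρ a ≠ 0 →
      T.Adj v a ∧ G.Adj v a ∧ T.dist ρ a = T.dist ρ v + 1 := by
    rintro a v rfl h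
    exact ⟨(hdep' a h).1.symm, hTG (hdep' a h).1.symm, (hdep' a h).2⟩
  have root : ∀ {a b v}, par a = v → T.dist ρ a ≠ 0 → par b = v → T.dist ρ b ≠ 0 →
      T.dist ρ v = 0 → a = b := by
    intro a b v ha ha' hb hb' hv
    obtain rfl := (hdep v).1 hv
    exact hρ a b (kid ha ha').1 (kid hb hb').1
  let S : ConflictTree V :=
    { par := par
      dep := T.dist ρ
      Conf := fun u v => G.Adj u v ∧ ¬ T.Adj u v ∧ T.dist ρ u % 2 = T.dist ρ v % 2
      dep_par := fun v hv => (hdep' v hv).2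
      par_root := fun v hv => by
        obtain rfl := (hdep v).1 hv
        exact hpar0 v rfl
      root_unique := fun v w hv hw => by rw [(hdep v).1 hv, (hdep w).1 hw]
      root_child := fun v w hv hw => hρ v w (dist_eq_one_iff_adj.1 hv) (dist_eq_one_iff_adj.1 hw)
      symm := fun x y h => ⟨h.1.symm, fun h' => h.2.1 h'.symm, h.2.2.symm⟩
      parity := fun x y h => h.2.2
      irrefl := fun x h => G.loopless.irrefl x h.1
      triangle := fun x y z h1 h2 h3 => htri x y z h1.1 h2.1 h3.1
      par_ne := fun x y h e => by
        by_cases hx : T.dist ρ x = 0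
        · by_cases hy : T.dist ρ y = 0
          · exact h.1.ne (by rw [(hdep x).1 hx, (hdep y).1 hy])
          · refine h.2.1 ((hadj x y).2 (Or.inr ⟨hy, ?_⟩))
            rw [← e, (hdep x).1 hx]
            exact hpar0 ρ rfl
        · by_cases hy : T.dist ρ y = 0
          · refine h.2.1 ((hadj x y).2 (Or.inl ⟨hx, ?_⟩))
            rw [e, (hdep y).1 hy]
            exact hpar0 ρ rfl
          -- A common parent would close a triangle; the cases before it arise because the root is
          -- its own parent.
          · exact htri x (par x) y (hTG (hdep' x hx).1) (e ▸ (kid rfl hy).2.1) h.1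
      grandpar_ne := fun x y h e => by
        by_cases hx : T.dist ρ x = 0
        · have e' := hpar0 x ((hdep x).1 hx)
          rw [e', hpar0 ρ rfl] at e
          exact h.1.ne (((hdep x).1 hx).trans e)
        · by_cases hx' : T.dist ρ (par x) = 0
          · refine h.2.1 ((hadj x y).2 (Or.inl ⟨hx, ?_⟩))
            rw [← e, hpar0 (par x) ((hdep _).1 hx'), (hdep _).1 hx']
          · exact htri x (par x) y (hTG (hdep' x hx).1) (e ▸ hTG (hdep' _ hx').1) h.1
      deg_kkk := fun a b c hab hac ha hb hc => by
        have ka := kid rfl ha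
        have kb := kid hab.symm hb
        have kc := kid hac.symm hc
        by_cases hv : T.dist ρ (par a) = 0
        · exact Or.inl (root rfl ha hab.symm hb hv)
        · have kv := hdep' _ hv
          rcases four_adj_of_maxDegree_le hdeg ka.2.1 kb.2.1 kc.2.1 (hTG kv.1) with
            e | e | e | e | e | e
          · exact Or.inl e
          · exact Or.inr (Or.inl e)
          · rw [← e] at kv; omega
          · exact Or.inr (Or.inr e)
          · rw [← e] at kv; omega
          · rw [← e] at kv; omega
      deg_kkc := fun v a b y ha hb ha' hb' h => by
        have ka := kid ha ha'
        have kb := kid hb hb'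
        by_cases hv : T.dist ρ v = 0
        · exact root ha ha' hb hb' hv
        · have kv := hdep' _ hv
          rcases four_adj_of_maxDegree_le hdeg ka.2.1 kb.2.1 h.1 (hTG kv.1) with
            e | e | e | e | e | e
          · exact e
          · exact absurd (e ▸ ka.1) h.2.1
          · rw [← e] at kv; omega
          · exact absurd (e ▸ kb.1) h.2.1
          · rw [← e] at kv; omega
          · exact absurd (e ▸ kv.1) h.2.1
      deg_kcc := fun v a y z ha ha' hv hy hz => by
        have ka := kid ha ha'
        have kv := hdep' _ hv
        rcases four_adj_of_maxDegree_le hdeg ka.2.1 hy.1 hz.1 (hTG kv.1) with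
          e | e | e | e | e | e
        · exact absurd (e ▸ ka.1) hy.2.1
        · exact absurd (e ▸ ka.1) hz.2.1
        · rw [← e] at kv; omega
        · exact e
        · exact absurd (e ▸ kv.1) hy.2.1
        · exact absurd (e ▸ kv.1) hz.2.1
      deg_ccc := fun v x y z hv hx hy hz => by
        have kv := hdep' _ hv
        rcases four_adj_of_maxDegree_le hdeg hx.1 hy.1 hz.1 (hTG kv.1) with
          e | e | e | e | e | e
        · exact Or.inl e
        · exact Or.inr (Or.inl e)
        · exact absurd (e ▸ kv.1) hx.2.1
        · exact Or.inr (Or.inr e)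
        · exact absurd (e ▸ kv.1) hy.2.1
        · exact absurd (e ▸ kv.1) hz.2.1 }
  exact ⟨S, hadj, fun u v => Iff.rfl⟩

/-! ### Randomly flipped components and separation counts. -/

namespace ConflictTree

variable {V : Type*} (S : ConflictTree V)

open Classical in
/-- The topmost vertex of the component of `v` after deleting the tree edges of colour `r`. -/
noncomputable def top (c : V → ZMod 3) (r : ZMod 3) (v : V) : V :=
  if _h : S.dep v = 0 then v else if c v = r then v else top c r (S.par v)
termination_by S.dep v
decreasing_by have := S.dep_par v _h; omega

variable {S} {c : V → ZMod 3} {r : ZMod 3}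

theorem top_of_eq {v : V} (h : c v = r) : S.top c r v = v := by
  rw [top, if_pos h]
  split <;> rfl

theorem top_of_ne {v : V} (hv : S.dep v ≠ 0) (h : c v ≠ r) :
    S.top c r v = S.top c r (S.par v) := by
  rw [top, dif_neg hv, if_neg h]

theorem top_of_dep {v : V} (hv : S.dep v = 0) : S.top c r v = v := by
  rw [top, dif_pos hv]

theorem dep_top_le (v : V) : S.dep (S.top c r v) ≤ S.dep v := by
  induction hn : S.dep v generalizing v with
  | zero => rw [top_of_dep hn, hn]
  | succ n ih =>
    by_cases h : c v = r
    · rw [top_of_eq h, hn]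
    · rw [top_of_ne (by omega) h]
      have := ih (S.par v) (dep_par_of_pos hn)
      omega

/-- The climb to the top stops at edges of colour `r`, so it never crosses the edge above `z`. -/
theorem anc_top_iff {z : V} (hz : c z = r) (v : V) : S.Anc z (S.top c r v) ↔ S.Anc z v := by
  induction hn : S.dep v generalizing v with
  | zero => rw [top_of_dep hn]
  | succ n ih =>
    by_cases h : c v = r
    · rw [top_of_eq h]
    · rw [top_of_ne (by omega) h, ih (S.par v) (dep_par_of_pos hn), S.anc_iff z v]
      constructor
      · exact fun h' => Or.inr ⟨by omega, h'⟩
      · rintro (rfl | h')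
        · exact absurd hz h
        · exact h'.2

theorem top_ne_of_anc {x y z : V} (hz : c z = r) (h : ¬ (S.Anc z x ↔ S.Anc z y)) :
    S.top c r x ≠ S.top c r y := by
  intro e
  rw [← anc_top_iff hz, ← anc_top_iff hz (v := y), e] at h
  exact h Iff.rfl

theorem top_ne_par {v : V} (hv : S.dep v ≠ 0) (h : c v = r) :
    S.top c r v ≠ S.top c r (S.par v) := by
  intro e
  rw [top_of_eq h] at e
  have h1 := dep_top_le (S := S) (c := c) (r := r) (S.par v)
  have h2 := S.dep_par v hv
  rw [← e] at h1
  omega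

variable (S) in
/-- The side of the cut on which `v` lies when the component with topmost vertex `t` is flipped
according to `ξ t`. -/
def Side (c : V → ZMod 3) (r : ZMod 3) (ξ : V → Bool) (v : V) : Prop :=
  ¬ (S.dep v % 2 = 0 ↔ ξ (S.top c r v) = true)

open Classical in
variable (S) in
/-- The number of flips for which `u` and `v` lie on different sides. -/
noncomputable def separations [Fintype V] (c : V → ZMod 3) (r : ZMod 3) (u v : V) : ℝ :=
  ∑ ξ : V → Bool, if S.Side c r ξ u ↔ S.Side c r ξ v then 0 else 1

variable [Fintype V]

theorem separations_comm (u v : V) : S.separations c r u v = S.separations c r v u := by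
  classical
  exact Finset.sum_congr rfl fun ξ _ => if_congr iff_comm rfl rfl

theorem separations_of_eq {u v : V} (h : S.top c r u = S.top c r v)
    (hd : S.dep u % 2 ≠ S.dep v % 2) :
    S.separations c r u v = 2 ^ Fintype.card V := by
  classical
  have : ∀ ξ : V → Bool, ¬ (S.Side c r ξ u ↔ S.Side c r ξ v) := by
    intro ξ
    unfold Side
    rw [h]
    have : S.dep u % 2 = 0 ↔ ¬ S.dep v % 2 = 0 := by omega
    tauto
  simp [separations, this]

/-- Toggling `ξ` at the top of `u` is an involution that moves `u` and leaves `v` in place, so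
exactly half of the flips separate them. -/
theorem separations_of_ne {u v : V} (h : S.top c r u ≠ S.top c r v) :
    S.separations c r u v = 2 ^ Fintype.card V / 2 := by
  classical
  let f : (V → Bool) → ℝ := fun ξ => if S.Side c r ξ u ↔ S.Side c r ξ v then 0 else 1
  let flip : (V → Bool) → V → Bool := fun ξ =>
    Function.update ξ (S.top c r u) (!(ξ (S.top c r u)))
  have hflip : Function.Involutive flip := by
    intro ξ
    ext t
    by_cases ht : t = S.top c r u
    · subst ht
      simp [flip]
    · simp [flip, Function.update_of_ne ht]
  have h1 : ∑ ξ, f (flip ξ) = ∑ ξ, f ξ := Equiv.sum_comp hflip.toPerm f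
  have h2 : ∀ ξ, f ξ + f (flip ξ) = 1 := by
    intro ξ
    have e1 : S.Side c r (flip ξ) u ↔ ¬ S.Side c r ξ u := by
      simp only [Side, flip, Function.update_self]
      cases ξ (S.top c r u) <;> simp
    have e2 : S.Side c r (flip ξ) v ↔ S.Side c r ξ v := by
      simp only [Side, flip, Function.update_of_ne h.symm]
    simp only [f, e1, e2]
    by_cases p : S.Side c r ξ u <;> by_cases q : S.Side c r ξ v <;> simp [p, q]
  have h3 : ∑ ξ, f ξ + ∑ ξ, f (flip ξ) = 2 ^ Fintype.card V := by
    rw [← Finset.sum_add_distrib, Finset.sum_congr rfl fun ξ _ => h2 ξ]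
    simp
  rw [h1] at h3
  change ∑ ξ, f ξ = _
  linarith

theorem le_separations {u v : V} (h : S.top c r u ≠ S.top c r v ∨ S.dep u % 2 ≠ S.dep v % 2) :
    (2 : ℝ) ^ Fintype.card V / 2 ≤ S.separations c r u v := by
  by_cases h' : S.top c r u = S.top c r v
  · rw [separations_of_eq h' (h.resolve_left (not_not.2 h'))]
    have : (0 : ℝ) ≤ 2 ^ Fintype.card V := by positivity
    linarith
  · rw [separations_of_ne h']

theorem sum_separations_par {v : V} (hv : S.dep v ≠ 0) :
    ∑ r, S.separations c r v (S.par v) = 2 ^ Fintype.card V * (5 / 2) := by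
  have hd := S.dep_par v hv
  have key : ∀ r, S.separations c r v (S.par v) =
      (2 : ℝ) ^ Fintype.card V - if c v = r then (2 : ℝ) ^ Fintype.card V / 2 else 0 := by
    intro r
    split_ifs with h
    · rw [separations_of_ne (top_ne_par hv h)]
      ring
    · rw [separations_of_eq (top_of_ne hv h) (by omega), sub_zero]
  rw [Finset.sum_congr rfl fun r _ => key r, Finset.sum_sub_distrib, Finset.sum_ite_eq]
  simp only [Finset.sum_const, Finset.card_univ, ZMod.card, Finset.mem_univ, if_true, nsmul_eq_mul]
  push_cast
  ring

end ConflictTree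

/-! ### Averaging the cut weights. -/

namespace WeightedCut

theorem weight_cut_le_mac {V : Type*} [Fintype V] (G : SimpleGraph V) (w : Sym2 V → ℝ)
    (p : V → Prop) : weight w (cut G {v | p v}) ≤ mac G w := by
  classical
  have h := Finset.le_sup' (fun A : Finset V => weight w (cut G (A : Set V)))
    (Finset.mem_univ (Finset.univ.filter p))
  have e : ((Finset.univ.filter p : Finset V) : Set V) = {v | p v} := by
    ext v
    simp
  rw [← e]
  exact h

open Classical in
theorem weight_cut_eq {V : Type*} [Fintype V] (G : SimpleGraph V) (w : Sym2 V → ℝ)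
    (p : V → Prop) : weight w (cut G {v | p v}) =
      ∑ e ∈ G.edgeFinset, if e ∈ (cut G {v | p v}).edgeSet then w e else 0 := by
  rw [weight, ← Finset.sum_filter]
  refine Finset.sum_congr ?_ fun _ _ => rfl
  ext e
  simp only [SimpleGraph.mem_edgeFinset, Finset.mem_filter]
  exact ⟨fun h => ⟨SimpleGraph.edgeSet_mono SimpleGraph.between_le h, h⟩, fun h => h.2⟩

theorem mem_edgeSet_cut {V : Type*} {G : SimpleGraph V} {p : V → Prop} {u v : V}
    (h : G.Adj u v) : s(u, v) ∈ (cut G {v | p v}).edgeSet ↔ ¬ (p u ↔ p v) := by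
  rw [SimpleGraph.mem_edgeSet, cut, SimpleGraph.between_adj]
  simp only [Set.mem_ofPred_eq, Set.mem_compl_iff]
  tauto

/-- In a triangle-free subcubic graph, a spanning tree contributes a third of its weight to the
maximum cut beyond half of the total weight. -/
theorem weight_half_add_third_le_mac {V : Type*} [Fintype V] (G T : SimpleGraph V)
    [DecidableRel G.Adj] (w : Sym2 V → ℝ) (hw : ∀ e ∈ G.edgeSet, 0 ≤ w e)
    (hfree : G.CliqueFree 3) (hdeg : G.maxDegree ≤ 3) (hTG : T ≤ G) (hT : T.IsTree) :
    weight w G / 2 + weight w T / 3 ≤ mac G w := by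
  classical
  obtain ⟨S, hadj, hconf⟩ := exists_conflictTree hfree hdeg hTG hT
  obtain ⟨c, hc⟩ := S.exists_colouring
  set N : ℝ := 2 ^ Fintype.card V with hN
  have hNpos : 0 < N := by
    rw [hN]
    positivity
  -- Summed over the three colours, a tree edge is cut in a proportion 1 + 1 + 1/2 = 3/2 + 1 of the
  -- `N` flips, and any other edge in at least 3 · 1/2.
  have hsep : ∀ e ∈ G.edgeSet, N * (3 / 2 * w e + if e ∈ T.edgeSet then w e else 0) ≤
      ∑ r : ZMod 3, ∑ ξ : V → Bool,
        if e ∈ (cut G {v | S.Side c r ξ v}).edgeSet then w e else 0 := by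
    intro e he
    have hwe := hw e he
    induction e using Sym2.ind with
    | _ u v =>
      have huv : G.Adj u v := he
      have e1 : ∀ r : ZMod 3, (∑ ξ : V → Bool,
          if s(u, v) ∈ (cut G {v | S.Side c r ξ v}).edgeSet then w s(u, v) else 0) =
          S.separations c r u v * w s(u, v) := by
        intro r
        rw [ConflictTree.separations, Finset.sum_mul]
        refine Finset.sum_congr rfl fun ξ _ => ?_
        have h := mem_edgeSet_cut (p := S.Side c r ξ) huv
        by_cases p : S.Side c r ξ u ↔ S.Side c r ξ v <;> simp [h, p]
      rw [Finset.sum_congr rfl fun r _ => e1 r, ← Finset.sum_mul]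
      by_cases hTe : T.Adj u v
      · have e2 : ∑ r, S.separations c r u v = N * (5 / 2) := by
          rcases (hadj u v).1 hTe with ⟨h, rfl⟩ | ⟨h, rfl⟩
          · exact ConflictTree.sum_separations_par h
          · rw [Finset.sum_congr rfl fun r _ => ConflictTree.separations_comm _ _]
            exact ConflictTree.sum_separations_par h
        rw [e2, if_pos (show s(u, v) ∈ T.edgeSet from hTe)]
        exact le_of_eq (by ring)
      · have e2 : N * (3 / 2) ≤ ∑ r : ZMod 3, S.separations c r u v := by
          have e3 : ∀ r ∈ (Finset.univ : Finset (ZMod 3)), N / 2 ≤ S.separations c r u v := by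
            intro r _
            apply ConflictTree.le_separations
            by_cases hp : S.dep u % 2 = S.dep v % 2
            · obtain ⟨z, hz, hz'⟩ := hc u v ((hconf u v).2 ⟨huv, hTe, hp⟩) r
              exact Or.inl (ConflictTree.top_ne_of_anc hz hz')
            · exact Or.inr hp
          have e4 := Finset.card_nsmul_le_sum _ _ _ e3
          rw [Finset.card_univ, ZMod.card, nsmul_eq_mul] at e4
          push_cast at e4
          linarith
        rw [if_neg (show s(u, v) ∉ T.edgeSet from hTe), add_zero, ← mul_assoc]
        exact mul_le_mul_of_nonneg_right e2 hwe
  have hT' : weight w T = ∑ e ∈ G.edgeFinset, if e ∈ T.edgeSet then w e else 0 := by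
    rw [weight, ← Finset.sum_filter]
    refine Finset.sum_congr ?_ fun _ _ => rfl
    ext e
    simp only [SimpleGraph.mem_edgeFinset, Finset.mem_filter]
    exact ⟨fun h => ⟨SimpleGraph.edgeSet_mono hTG h, h⟩, fun h => h.2⟩
  have hG' : weight w G = ∑ e ∈ G.edgeFinset, w e := by
    rw [weight]
    refine Finset.sum_congr ?_ fun _ _ => rfl
    ext e
    simp only [SimpleGraph.mem_edgeFinset]
  have hlow : N * (3 / 2 * weight w G + weight w T) ≤
      ∑ r : ZMod 3, ∑ ξ : V → Bool, weight w (cut G {v | S.Side c r ξ v}) := by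
    have h := Finset.sum_le_sum fun e (he : e ∈ G.edgeFinset) =>
      hsep e (SimpleGraph.mem_edgeFinset.1 he)
    rw [← Finset.mul_sum, Finset.sum_add_distrib, ← Finset.mul_sum, ← hG', ← hT',
      Finset.sum_comm] at h
    refine h.trans (le_of_eq (Finset.sum_congr rfl fun r _ => ?_))
    rw [Finset.sum_comm]
    refine Finset.sum_congr rfl fun ξ _ => ?_
    rw [weight_cut_eq]
    refine Finset.sum_congr ?_ fun _ _ => rfl
    ext e
    simp only [SimpleGraph.mem_edgeFinset]
  have hup : ∑ r : ZMod 3, ∑ ξ : V → Bool, weight w (cut G {v | S.Side c r ξ v}) ≤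
      N * (3 * mac G w) := by
    calc _ ≤ ∑ _r : ZMod 3, ∑ _ξ : V → Bool, mac G w :=
          Finset.sum_le_sum fun r _ => Finset.sum_le_sum fun ξ _ => weight_cut_le_mac G w _
      _ = N * (3 * mac G w) := by
          simp only [Finset.sum_const, Finset.card_univ, ZMod.card, nsmul_eq_mul, hN, Fintype.card_fun,
            Fintype.card_bool]
          push_cast
          ring
  have := le_of_mul_le_mul_left (hlow.trans hup) hNpos
  linarith

theorem weight_nonneg {V : Type*} [Fintype V] {w : Sym2 V → ℝ} {H : SimpleGraph V}
    (hw : ∀ e ∈ H.edgeSet, 0 ≤ w e) : 0 ≤ weight w H := by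
  classical
  exact Finset.sum_nonneg fun e he => hw e (SimpleGraph.mem_edgeFinset.1 he)

end WeightedCut

theorem theorem5p2 {V : Type*} [Fintype V] (G T : SimpleGraph V) [DecidableRel G.Adj]
    (w : Sym2 V → ℝ) (hw : ∀ e ∈ G.edgeSet, 0 ≤ w e)
    (hfree : G.CliqueFree 3) (hdeg : G.maxDegree ≤ 3)
    (hTG : T ≤ G) (hT : T.IsTree) :
    WeightedCut.weight w G / 2 + 0.3193 * WeightedCut.weight w T ≤ WeightedCut.mac G w := by
  have h1 := WeightedCut.weight_half_add_third_le_mac G T w hw hfree hdeg hTG hT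
  have h2 := WeightedCut.weight_nonneg (H := T) (w := w) fun e he =>
    hw e (SimpleGraph.edgeSet_mono hTG he)
  -- Since `w(T)` is nonnegative, 1/3 may be lowered to 0.3193.
  linarith
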